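/- For a finite Abelian group $G$, subsets $A,B\subseteq G$ and a real number $\eta$, say that $A$ is $(B,\eta)$-closed if $|\{(a,b)\in A\times B: a+b\in A\}|\ge \eta|A||B|$. For $f,g:G\to\mathbb R$ let $(f*g)(x)=\mathbb E_{y+z=x}f(y)g(z)$, and for non-empty $B\subseteq G$ let $\mu_B$ be the function equal to $|G|/|B|$ on $B$ and $0$ elsewhere. For real $\eta,\epsilon,c,\delta>0$ and a positive integer $l$, let $P(\eta,\epsilon,c,\delta,l)$ be the following assertion: for every finite Abelian group $G$ and all non-empty $A,B\subseteq G$ such that $A$ is $(B,\eta)$-closed, there are a subset $B'\subseteq B$ and a non-empty subset $C\subseteq G$ such that (1) $|B'|\ge\delta|B|$; (2) $C$ is $(B',1-\epsilon)$-closed; (3) $1_A*\mu_B*\dots*\mu_B*\mu_{-B}*\dots*\mu_{-B}(x)\ge c$ for every $x\in C$, where the convolution has $l$ factors $\mu_B$ and $l$ factors $\mu_{-B}$. For $v\in\mathbb F_2^n$ let $|v|$ be the number of coordinates of $v$ equal to $1$, and let $A_n=\{v\in\mathbb F_2^n:|v|\le n/2-10^{20}n^{3/4}\}$ and $B_n=\{v\in\mathbb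 F_2^n:|v|=\lfloor n^{1/2}\rfloor\}$. Write $lB_n$ for the $l$-fold sumset $B_n+\dots+B_n$. Then there is an absolute constant $\eta>0$ such that the following hold. (i) For all sufficiently large $n$, $A_n$ is $(B_n,\eta)$-closed. (ii) For every $\delta>0$ and every positive integer $l$, if $n$ is sufficiently large (in terms of $\delta$ and $l$), then there do not exist a non-empty set $C\subseteq A_n+lB_n$ and a set $B'\subseteq B_n$ with $|B'|\ge\delta|B_n|$ such that $C$ is $(B',0.99)$-closed. (iii) $P(\eta,0.01,c,\delta,l)$ fails for all $c,\delta>0$ and all positive integers $l$. In particular, it is not true that for all $\eta,\epsilon>0$ there are $c,\delta>0$ and a positive integer $l$ such that $P(\eta,\epsilon,c,\delta,l)$ holds. -/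

import Mathlib

open scoped Pointwise

noncomputable section

/-- `A` is `(B, η)`-closed: `|{(a, b) ∈ A × B : a + b ∈ A}| ≥ η |A| |B|`. -/
def IsClosedWrt {G : Type} [AddCommGroup G] [DecidableEq G]
    (B : Finset G) (η : ℝ) (A : Finset G) : Prop :=
  η * (A.card : ℝ) * (B.card : ℝ) ≤
    (((A ×ˢ B).filter (fun p => p.1 + p.2 ∈ A)).card : ℝ)

/-- The `l`-fold sumset `lB = B + ⋯ + B`, with `0B = {0}`. -/
def iterSumset {G : Type} [AddCommGroup G] [DecidableEq G] (B : Finset G) : ℕ → Finset G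
  | 0 => {0}
  | l + 1 => iterSumset B l + B

/-- The indicator function of `A`. -/
def ind {G : Type} [DecidableEq G] (A : Finset G) (x : G) : ℝ :=
  if x ∈ A then 1 else 0

/-- The characteristic measure `μ_B`: the value `|G| / |B|` on `B`, and `0` elsewhere. -/
def charMeasure {G : Type} [Fintype G] [DecidableEq G] (B : Finset G) (x : G) : ℝ :=
  if x ∈ B then (Fintype.card G : ℝ) / (B.card : ℝ) else 0

/-- The convolution `(f * g)(x)`, the average of `f y * g z` over all pairs with `y + z = x`. -/
def conv {G : Type} [AddCommGroup G] [Fintype G] (f g : G → ℝ) (x : G) : ℝ :=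
  (∑ y : G, f y * g (x - y)) / (Fintype.card G : ℝ)

/-- `f * g * ⋯ * g`, with `l` factors `g`. -/
def convIter {G : Type} [AddCommGroup G] [Fintype G] (f g : G → ℝ) : ℕ → G → ℝ
  | 0 => f
  | l + 1 => conv (convIter f g l) g

/-- The assertion, for given parameters, that whenever `A` is `(B, η)`-closed in a finite Abelian
group `G`, with `A` and `B` non-empty, there are `B' ⊆ B` and a non-empty `C ⊆ G` such that
`|B'| ≥ δ |B|`, `C` is `(B', 1 - ε)`-closed, and `1_A * μ_B * ⋯ * μ_B * μ_{-B} * ⋯ * μ_{-B} ≥ c`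
on `C`, with `l` factors `μ_B` and `l` factors `μ_{-B}`. -/
def ClosedStructure (η ε c δ : ℝ) (l : ℕ) : Prop :=
  ∀ (G : Type) [AddCommGroup G] [Fintype G] [DecidableEq G] (A B : Finset G),
    A.Nonempty → B.Nonempty → IsClosedWrt B η A →
      ∃ B' C : Finset G, B' ⊆ B ∧ C.Nonempty ∧
        δ * (B.card : ℝ) ≤ (B'.card : ℝ) ∧
        IsClosedWrt B' (1 - ε) C ∧
        ∀ x ∈ C, c ≤ convIter (convIter (ind A) (charMeasure B) l) (charMeasure (-B)) l x

/-- A positive answer to the question: suitable `c`, `δ`, `l` exist for all `η` and `ε`. -/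
def ClosedStructureQuestion : Prop :=
  ∀ η : ℝ, 0 < η → ∀ ε : ℝ, 0 < ε →
    ∃ c : ℝ, 0 < c ∧ ∃ δ : ℝ, 0 < δ ∧ ∃ l : ℕ, 0 < l ∧ ClosedStructure η ε c δ l

/-- The set of all `v ∈ 𝔽₂ⁿ` with `|v| ≤ n / 2 - 10 ^ 20 * n ^ (3 / 4)`. -/
def lowSet (n : ℕ) : Finset (Fin n → ZMod 2) :=
  Finset.univ.filter
    (fun v => (hammingNorm v : ℝ) ≤ (n : ℝ) / 2 - 10 ^ 20 * (n : ℝ) ^ (3 / 4 : ℝ))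

/-- The set of all `v ∈ 𝔽₂ⁿ` with `|v| = ⌊n ^ (1 / 2)⌋`. -/
def sqrtLayer (n : ℕ) : Finset (Fin n → ZMod 2) :=
  Finset.univ.filter (fun v => hammingNorm v = Nat.sqrt n)

end

/-!
Write `m = ⌊√n⌋`, let `χ_v ∈ {1, -1}ⁿ` be the sign vector of `v`, and let `s(v) = n - 2 |v|` be its
bias. Adding to `v` the indicator vector of the entries of an injective tuple `ω` of length `m`
changes the bias by `-2 ∑ⱼ χ_v(ωⱼ)`. Since `m² ≤ n`, at least half of all tuples of length `m` are
injective, and each vector of weight `m` comes from `m!` of them. So a set of density `δ` in the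
layer corresponds to a set of density at least `δ / 2` among all tuples, and moments can be computed
for independent samples.

*The low set is closed with constant density.* Starting `4 K n ^ (1 / 4)` levels below the boundary
of the ball of radius `n / 2 - K n ^ (3 / 4)`, half of the steps stay in the ball by Chebyshev's
inequality (`half_le_card_steps_in_ball`). The binomial coefficients of consecutive levels near the
boundary differ by a factor `1 + O(n ^ (-1 / 4))`, so the smaller ball has a constant proportion of
the points (`card_hammingBall_le_mul`).

*No set of large bias is almost closed under a dense set of steps.* Suppose 99 percent of the pairs
in `C × B'` stay in `C`. A step is its own inverse, so `(v, b) ↦ (v + b, b)` is an involution of the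
pairs that stay, and it negates `∑ⱼ χ_v(ωⱼ)`. This has two consequences.

* At least half of the staying pairs have `∑ⱼ χ_v(ωⱼ) ≤ 0` (`card_nonincreasing_steps_ge`), which for
  `v ∈ C` is a deviation from the mean by many standard deviations `√m`.
* For each fixed `u`, hardly any point `v` of the core of `C`, formed by the points from which half
  of the steps stay, has `|s(u + v)|` much larger than `n ^ (3 / 4)`: Chebyshev's inequality shows
  that nearly all steps, from either end, would have to decrease `|s(u + v)|`
  (`card_stayCore_biased_le`). As `s(u + v)` is the inner product of the sign vectors, most
  pairs of points of the core have nearly uncorrelated sign vectors.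

By a fourth moment computation (`sum_tupleSum_sq_mul_sq`), the squared centred sums attached to
nearly uncorrelated sign vectors are nearly uncorrelated functions of the tuple. Their average over
the core therefore has small variance, and by Cauchy-Schwarz its mean over the dense set of tuples is
at most twice the typical value `m` (`sum_sq_tupleSum_le`). This contradicts the first consequence
(`not_almost_closed`).

The convolution in the failing assertion is supported in `A + 2 l B`, because `-B = B`, so the second
result, applied with `2 l` in place of `l`, refutes the assertion.
-/

/-! ### Moments of sums over independent samples -/

/-- The sum of `y` over the entries of the tuple `ω`. -/
def tupleSum {n m : ℕ} (y : Fin n → ℝ) (ω : Fin m → Fin n) : ℝ := ∑ j, y (ω j)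

lemma sum_tuple_succ {n m : ℕ} (F : (Fin (m + 1) → Fin n) → ℝ) :
    ∑ ω, F ω = ∑ i, ∑ ω : Fin m → Fin n, F (Fin.cons i ω) := by
  rw [← Fintype.sum_prod_type']
  exact (Fintype.sum_equiv (Fin.consEquiv (fun _ => Fin n)) _ _ (fun _ => rfl)).symm

lemma tupleSum_cons {n m : ℕ} (y : Fin n → ℝ) (i : Fin n) (ω : Fin m → Fin n) :
    tupleSum y (Fin.cons i ω : Fin (m + 1) → Fin n) = y i + tupleSum y ω := by
  simp [tupleSum, Fin.sum_univ_succ]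

lemma sum_tuple_one (n m : ℕ) : ∑ _ω : Fin m → Fin n, (1 : ℝ) = (n : ℝ) ^ m := by
  simp

lemma sum_tupleSum {n : ℕ} (y : Fin n → ℝ) (hy : ∑ i, y i = 0) (m : ℕ) :
    ∑ ω : Fin m → Fin n, tupleSum y ω = 0 := by
  induction m with
  | zero => simp [tupleSum]
  | succ m ih =>
    rw [sum_tuple_succ]
    simp only [tupleSum_cons, Finset.sum_add_distrib, ih, Finset.sum_const, add_zero,
      smul_zero, ← Finset.smul_sum, hy]

/-- The covariance of two sums of independent centred samples is additive in their number. -/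
lemma sum_tupleSum_mul {n : ℕ} (y z : Fin n → ℝ) {ρ : ℝ} (hy : ∑ i, y i = 0)
    (hz : ∑ i, z i = 0) (hyz : ∑ i, y i * z i = n * ρ) (m : ℕ) :
    ∑ ω : Fin m → Fin n, tupleSum y ω * tupleSum z ω = (n : ℝ) ^ m * (m * ρ) := by
  induction m with
  | zero => simp [tupleSum]
  | succ m ih =>
    rw [sum_tuple_succ]
    have key : ∀ i, ∑ ω : Fin m → Fin n, tupleSum y (Fin.cons i ω : Fin (m + 1) → Fin n) *
        tupleSum z (Fin.cons i ω : Fin (m + 1) → Fin n) =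
        (n : ℝ) ^ m * (y i * z i) + (n : ℝ) ^ m * (m * ρ) := by
      intro i
      have : ∀ ω : Fin m → Fin n, tupleSum y (Fin.cons i ω : Fin (m + 1) → Fin n) *
          tupleSum z (Fin.cons i ω : Fin (m + 1) → Fin n) =
          y i * z i * 1 + y i * tupleSum z ω + z i * tupleSum y ω +
            tupleSum y ω * tupleSum z ω := by
        intro ω; rw [tupleSum_cons, tupleSum_cons]; ring
      simp only [this, Finset.sum_add_distrib, ← Finset.mul_sum, sum_tupleSum y hy,
        sum_tupleSum z hz, ih, sum_tuple_one]
      ring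
    simp only [key, Finset.sum_add_distrib, ← Finset.mul_sum, hyz, Finset.sum_const,
      Finset.card_univ, Fintype.card_fin, nsmul_eq_mul]
    push_cast
    ring

/-- The mixed fourth moment of two sums of independent centred samples: up to terms linear in the
number of samples, the squares have covariance `2 (m ρ)²`. -/
lemma sum_tupleSum_sq_mul_sq {n : ℕ} (y z : Fin n → ℝ) {σ τ ρ q : ℝ} (hy : ∑ i, y i = 0)
    (hz : ∑ i, z i = 0) (hyy : ∑ i, y i * y i = n * σ) (hzz : ∑ i, z i * z i = n * τ)
    (hyz : ∑ i, y i * z i = n * ρ) (hq : ∑ i, y i ^ 2 * z i ^ 2 = n * q) (m : ℕ) :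
    ∑ ω : Fin m → Fin n, tupleSum y ω ^ 2 * tupleSum z ω ^ 2 =
      (n : ℝ) ^ m * (m * q + m * (m - 1) * (σ * τ + 2 * ρ ^ 2)) := by
  induction m with
  | zero => simp [tupleSum]
  | succ m ih =>
    rw [sum_tuple_succ]
    set A := ∑ ω : Fin m → Fin n, tupleSum y ω * tupleSum z ω ^ 2 with hA
    set B := ∑ ω : Fin m → Fin n, tupleSum y ω ^ 2 * tupleSum z ω with hB
    have key : ∀ i, ∑ ω : Fin m → Fin n, tupleSum y (Fin.cons i ω : Fin (m + 1) → Fin n) ^ 2 *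
        tupleSum z (Fin.cons i ω : Fin (m + 1) → Fin n) ^ 2 =
        (n : ℝ) ^ m * (y i ^ 2 * z i ^ 2) + (n : ℝ) ^ m * (m * τ) * (y i * y i) +
        (n : ℝ) ^ m * (m * σ) * (z i * z i) + 4 * (n : ℝ) ^ m * (m * ρ) * (y i * z i) +
        2 * A * y i + 2 * B * z i +
        (n : ℝ) ^ m * (m * q + m * (m - 1) * (σ * τ + 2 * ρ ^ 2)) := by
      intro i
      have : ∀ ω : Fin m → Fin n, tupleSum y (Fin.cons i ω : Fin (m + 1) → Fin n) ^ 2 *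
          tupleSum z (Fin.cons i ω : Fin (m + 1) → Fin n) ^ 2 =
          y i ^ 2 * z i ^ 2 * 1 + (2 * y i ^ 2 * z i) * tupleSum z ω +
          y i ^ 2 * (tupleSum z ω * tupleSum z ω) +
          (2 * y i * z i ^ 2) * tupleSum y ω + (4 * y i * z i) * (tupleSum y ω * tupleSum z ω) +
          (2 * y i) * (tupleSum y ω * tupleSum z ω ^ 2) +
          z i ^ 2 * (tupleSum y ω * tupleSum y ω) +
          (2 * z i) * (tupleSum y ω ^ 2 * tupleSum z ω) +
            tupleSum y ω ^ 2 * tupleSum z ω ^ 2 := by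
        intro ω; rw [tupleSum_cons, tupleSum_cons]; ring
      simp only [this, Finset.sum_add_distrib, ← Finset.mul_sum, sum_tupleSum y hy,
        sum_tupleSum z hz, sum_tupleSum_mul y z hy hz hyz, sum_tupleSum_mul y y hy hy hyy,
        sum_tupleSum_mul z z hz hz hzz, ih, sum_tuple_one, ← hA, ← hB]
      ring
    simp only [key, Finset.sum_add_distrib, ← Finset.mul_sum, hyz, hyy, hzz, hq, hy, hz,
      Finset.sum_const, Finset.card_univ, Fintype.card_fin, nsmul_eq_mul]
    push_cast
    ring

/-- The centred version of `y`. -/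
noncomputable def centre {n : ℕ} (y : Fin n → ℝ) (i : Fin n) : ℝ := y i - (∑ k, y k) / n

lemma sum_centre {n : ℕ} (hn : 0 < n) (y : Fin n → ℝ) : ∑ i, centre y i = 0 := by
  have : (n : ℝ) ≠ 0 := by positivity
  simp only [centre, Finset.sum_sub_distrib, Finset.sum_const, Finset.card_univ,
    Fintype.card_fin, nsmul_eq_mul]
  field_simp
  ring

lemma sum_centre_mul {n : ℕ} (hn : 0 < n) (y z : Fin n → ℝ) :
    ∑ i, centre y i * centre z i =
      n * ((∑ i, y i * z i) / n - (∑ i, y i) / n * ((∑ i, z i) / n)) := by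
  have : (n : ℝ) ≠ 0 := by positivity
  have h : ∀ i, centre y i * centre z i = y i * z i - (∑ k, z k) / n * y i -
      (∑ k, y k) / n * centre z i := by intro i; simp only [centre]; ring
  simp only [h, Finset.sum_sub_distrib, ← Finset.mul_sum, sum_centre hn]
  field_simp
  ring

lemma tupleSum_centre {n m : ℕ} (y : Fin n → ℝ) (ω : Fin m → Fin n) :
    tupleSum (centre y) ω = tupleSum y ω - m * ((∑ k, y k) / n) := by
  simp [tupleSum, centre]

/-! ### Signs, drift and the layers of the cube -/

/-- The nontrivial character of `ZMod 2`, applied coordinatewise. -/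
def signVec {n : ℕ} (v : Fin n → ZMod 2) (i : Fin n) : ℝ := if v i = 0 then 1 else -1

/-- The bias `n - 2 |v|` of `v`, written as the sum of the signs of `v`. -/
def bias {n : ℕ} (v : Fin n → ZMod 2) : ℝ := ∑ i, signVec v i

/-- The indicator vector of the set of entries of a tuple. -/
def entryVec {n m : ℕ} (ω : Fin m → Fin n) (i : Fin n) : ZMod 2 :=
  if i ∈ Finset.univ.image ω then 1 else 0

lemma signVec_add {n : ℕ} (v w : Fin n → ZMod 2) (i : Fin n) :
    signVec (v + w) i = signVec v i * signVec w i := by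
  have h : ∀ a b : ZMod 2, a + b = 0 ↔ (a = 0 ↔ b = 0) := by decide
  simp only [signVec, Pi.add_apply, h]
  by_cases h1 : v i = 0 <;> by_cases h2 : w i = 0 <;> simp [h1, h2]

lemma signVec_mul_self {n : ℕ} (v : Fin n → ZMod 2) (i : Fin n) :
    signVec v i * signVec v i = 1 := by
  unfold signVec; split_ifs <;> norm_num

lemma abs_signVec {n : ℕ} (v : Fin n → ZMod 2) (i : Fin n) : |signVec v i| = 1 := by
  unfold signVec; split_ifs <;> norm_num

lemma bias_eq {n : ℕ} (v : Fin n → ZMod 2) : bias v = n - 2 * hammingNorm v := by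
  have h : ∀ i, signVec v i = 1 - 2 * (if v i ≠ 0 then 1 else 0) := by
    intro i; unfold signVec; split_ifs <;> (simp_all; try norm_num)
  simp only [bias, h, Finset.sum_sub_distrib, ← Finset.mul_sum, Finset.sum_boole, hammingNorm]
  simp

lemma abs_bias_le {n : ℕ} (v : Fin n → ZMod 2) : |bias v| ≤ n := by
  refine (Finset.abs_sum_le_sum_abs _ _).trans ?_
  simp [abs_signVec]

lemma abs_tupleSum_signVec_le {n m : ℕ} (v : Fin n → ZMod 2) (ω : Fin m → Fin n) :
    |tupleSum (signVec v) ω| ≤ m := by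
  refine (Finset.abs_sum_le_sum_abs _ _).trans ?_
  simp [abs_signVec]

lemma signVec_entryVec {n m : ℕ} (ω : Fin m → Fin n) (i : Fin n) :
    signVec (entryVec ω) i = 1 - 2 * (if i ∈ Finset.univ.image ω then 1 else 0) := by
  unfold signVec entryVec
  split_ifs <;> (simp_all; try norm_num)

lemma bias_add_entryVec {n m : ℕ} (v : Fin n → ZMod 2) {ω : Fin m → Fin n}
    (hω : Function.Injective ω) :
    bias (v + entryVec ω) = bias v - 2 * tupleSum (signVec v) ω := by
  have h : ∀ i, signVec (v + entryVec ω) i =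
      signVec v i - 2 * (if i ∈ Finset.univ.image ω then signVec v i else 0) := by
    intro i; rw [signVec_add, signVec_entryVec]; split_ifs <;> ring
  simp only [bias, h, Finset.sum_sub_distrib, ← Finset.mul_sum, Finset.sum_ite_mem,
    Finset.univ_inter]
  rw [Finset.sum_image (fun a _ b _ hab => hω hab)]
  rfl

lemma tupleSum_add_entryVec {n m : ℕ} (v : Fin n → ZMod 2) (ω : Fin m → Fin n) :
    tupleSum (signVec (v + entryVec ω)) ω = -tupleSum (signVec v) ω := by
  unfold tupleSum
  rw [← Finset.sum_neg_distrib]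
  refine Finset.sum_congr rfl fun j _ => ?_
  rw [signVec_add, signVec_entryVec, if_pos (by simp)]
  ring

lemma add_add_cancel_cube {n : ℕ} (v w : Fin n → ZMod 2) : v + w + w = v := by
  funext i
  rw [Pi.add_apply, Pi.add_apply, add_assoc, CharTwo.add_self_eq_zero, add_zero]

/-- Chebyshev's variance computation for the change of weight along a random tuple. -/
lemma sum_sq_tupleSum_signVec_le {n : ℕ} (hn : 0 < n) (v : Fin n → ZMod 2) (m : ℕ) :
    ∑ ω : Fin m → Fin n, (tupleSum (signVec v) ω - m * (bias v / n)) ^ 2 ≤ (n : ℝ) ^ m * m := by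
  have h := sum_tupleSum_mul (centre (signVec v)) (centre (signVec v)) (sum_centre hn _)
    (sum_centre hn _) (sum_centre_mul hn _ _) m
  simp only [tupleSum_centre, ← pow_two] at h
  have hb : bias v = ∑ k, signVec v k := rfl
  rw [hb, h]
  have h1 : (∑ i, signVec v i ^ 2) / (n : ℝ) = 1 := by
    have : (n : ℝ) ≠ 0 := by positivity
    simp only [pow_two, signVec_mul_self]
    simp [this]
  rw [h1]
  have : 0 ≤ ((∑ i, signVec v i) / (n : ℝ)) ^ 2 := by positivity
  have h3 : (m : ℝ) * (1 - ((∑ i, signVec v i) / (n : ℝ)) ^ 2) ≤ m := by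
    have : (0 : ℝ) ≤ m := by positivity
    nlinarith
  exact mul_le_mul_of_nonneg_left h3 (by positivity)

/-- A tuple that moves the weight in the direction opposite to the drift is rare once the bias is
large. -/
lemma card_against_drift_mul_le {n : ℕ} (hn : 0 < n) (v : Fin n → ZMod 2) (m : ℕ) :
    ((Finset.univ.filter
      (fun ω : Fin m → Fin n => bias v * tupleSum (signVec v) ω ≤ 0)).card : ℝ) *
      (m * (bias v / n)) ^ 2 ≤ (n : ℝ) ^ m * m := by
  refine le_trans ?_ (sum_sq_tupleSum_signVec_le hn v m)
  rw [← nsmul_eq_mul]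
  refine le_trans (Finset.card_nsmul_le_sum _
    (fun ω => (tupleSum (signVec v) ω - m * (bias v / n)) ^ 2) _ ?_)
    (Finset.sum_le_univ_sum_of_nonneg fun ω => sq_nonneg _)
  intro ω hω
  have hω := (Finset.mem_filter.1 hω).2
  have h1 : tupleSum (signVec v) ω * (m * (bias v / n)) ≤ 0 := by
    have : tupleSum (signVec v) ω * (m * (bias v / n)) =
      (m / n : ℝ) * (bias v * tupleSum (signVec v) ω) := by ring
    rw [this]
    exact mul_nonpos_of_nonneg_of_nonpos (by positivity) hω
  nlinarith [sq_nonneg (tupleSum (signVec v) ω)]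

/-! ### Almost closed sets avoid biased regions -/

lemma card_filter_product_eq_sum {α β : Type*} (s : Finset α) (t : Finset β)
    (P : α × β → Prop) [DecidablePred P] :
    ((s ×ˢ t).filter P).card = ∑ a ∈ s, (t.filter (fun b => P (a, b))).card := by
  simp only [Finset.card_filter, Finset.sum_product]

/-- The pairs of a point of `C` and a tuple of `Ω` for which the step stays inside `C`. -/
def stayPairs {n m : ℕ} (C : Finset (Fin n → ZMod 2)) (Ω : Finset (Fin m → Fin n)) :
    Finset ((Fin n → ZMod 2) × (Fin m → Fin n)) :=
  (C ×ˢ Ω).filter (fun p => p.1 + entryVec p.2 ∈ C)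

lemma mem_stayPairs {n m : ℕ} {C : Finset (Fin n → ZMod 2)} {Ω : Finset (Fin m → Fin n)}
    {p : (Fin n → ZMod 2) × (Fin m → Fin n)} :
    p ∈ stayPairs C Ω ↔ p.1 ∈ C ∧ p.2 ∈ Ω ∧ p.1 + entryVec p.2 ∈ C := by
  simp [stayPairs, and_assoc]

/-- Traversing a step backwards; an involution on the pairs that stay in a set. -/
def reversePair {n m : ℕ} (p : (Fin n → ZMod 2) × (Fin m → Fin n)) :
    (Fin n → ZMod 2) × (Fin m → Fin n) := (p.1 + entryVec p.2, p.2)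

lemma reversePair_reversePair {n m : ℕ} (p : (Fin n → ZMod 2) × (Fin m → Fin n)) :
    reversePair (reversePair p) = p := by
  simp [reversePair, add_add_cancel_cube]

/-- If `T` contains `a` or its image under an involution for every `a ∈ Q`, then `T` is at least
half as large as `Q`. -/
lemma card_le_two_mul_of_reverse {α : Type*} [DecidableEq α] (Q T : Finset α) (r : α → α)
    (hr : ∀ a, r (r a) = a) (h : ∀ a ∈ Q, a ∈ T ∨ r a ∈ T) : Q.card ≤ 2 * T.card := by
  have hsub : Q ⊆ T ∪ T.image r := by
    intro a ha
    rcases h a ha with h1 | h1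
    · exact Finset.mem_union_left _ h1
    · exact Finset.mem_union_right _ (Finset.mem_image.2 ⟨r a, h1, hr a⟩)
  calc Q.card ≤ (T ∪ T.image r).card := Finset.card_le_card hsub
    _ ≤ T.card + (T.image r).card := Finset.card_union_le _ _
    _ ≤ 2 * T.card := by have := Finset.card_image_le (s := T) (f := r); omega

/-- Within a dense set of tuples, those moving against the drift of a strongly biased vector form
a small proportion. -/
lemma card_against_drift_le {n m : ℕ} (hn : 0 < n) (hm : 0 < m) {Ω : Finset (Fin m → Fin n)}
    {δ ε θ : ℝ} (hε : 0 ≤ ε) (hθ : 0 < θ) (hΩ : δ * (n : ℝ) ^ m ≤ Ω.card)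
    (hA : (n : ℝ) ^ 2 ≤ ε * δ * m * θ ^ 2) {w : Fin n → ZMod 2} (hw : θ ≤ |bias w|) :
    ((Ω.filter (fun ω => bias w * tupleSum (signVec w) ω ≤ 0)).card : ℝ) ≤ ε * Ω.card := by
  have hn' : (0 : ℝ) < n := by exact_mod_cast hn
  have hm' : (0 : ℝ) < m := by exact_mod_cast hm
  set k : ℝ := ((Ω.filter (fun ω => bias w * tupleSum (signVec w) ω ≤ 0)).card : ℝ) with hk
  have hk0 : 0 ≤ k := Nat.cast_nonneg _
  have h1 : k * (m * (bias w / n)) ^ 2 ≤ (n : ℝ) ^ m * m := by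
    refine le_trans ?_ (card_against_drift_mul_le hn w m)
    refine mul_le_mul_of_nonneg_right ?_ (sq_nonneg _)
    rw [hk]
    exact_mod_cast Finset.card_le_card (Finset.filter_subset_filter _ (Finset.subset_univ _))
  have h2 : θ ^ 2 ≤ bias w ^ 2 := by
    rw [← sq_abs (bias w)]; exact pow_le_pow_left₀ hθ.le hw 2
  have h3 : k * (m * θ ^ 2) ≤ (n : ℝ) ^ m * n ^ 2 := by
    have e : k * (m * (bias w / n)) ^ 2 = k * (m * bias w ^ 2) * m / n ^ 2 := by
      field_simp
    rw [e, div_le_iff₀ (by positivity)] at h1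
    have : k * (m * bias w ^ 2) ≤ (n : ℝ) ^ m * n ^ 2 := by
      refine le_of_mul_le_mul_right ?_ hm'
      linarith
    refine le_trans ?_ this
    gcongr
  have h4 : k * (m * θ ^ 2) ≤ (ε * Ω.card) * (m * θ ^ 2) := by
    calc k * (m * θ ^ 2) ≤ (n : ℝ) ^ m * n ^ 2 := h3
      _ ≤ (n : ℝ) ^ m * (ε * δ * m * θ ^ 2) := by gcongr
      _ = ε * (δ * (n : ℝ) ^ m) * (m * θ ^ 2) := by ring
      _ ≤ ε * Ω.card * (m * θ ^ 2) := by gcongr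
  exact le_of_mul_le_mul_right h4 (by positivity)

/-- Few steps stay inside the part of `C` that is strongly correlated with `u`: such a step or its
reversal moves against the drift. -/
lemma card_stayPairs_biased_le {n m : ℕ} (hn : 0 < n) (hm : 0 < m)
    {C : Finset (Fin n → ZMod 2)} {Ω : Finset (Fin m → Fin n)}
    (hinj : ∀ ω ∈ Ω, Function.Injective ω) {δ ε θ : ℝ} (hε : 0 ≤ ε)
    (hθ : 2 * (m : ℝ) ≤ θ) (hΩ : δ * (n : ℝ) ^ m ≤ Ω.card)
    (hA : (n : ℝ) ^ 2 ≤ ε * δ * m * θ ^ 2) (u : Fin n → ZMod 2) :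
    (((stayPairs C Ω).filter (fun p => θ ≤ |bias (u + p.1)| ∧
      θ ≤ |bias (u + p.1 + entryVec p.2)|)).card : ℝ) ≤ 2 * ε * C.card * Ω.card := by
  have hm' : (0 : ℝ) < m := by exact_mod_cast hm
  have hθ0 : 0 < θ := by linarith
  set T := (C ×ˢ Ω).filter (fun p => θ ≤ |bias (u + p.1)| ∧
    bias (u + p.1) * tupleSum (signVec (u + p.1)) p.2 ≤ 0) with hT
  have hTcard : (T.card : ℝ) ≤ ε * C.card * Ω.card := by
    rw [hT, card_filter_product_eq_sum]
    push_cast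
    calc _ ≤ ∑ v ∈ C, ε * (Ω.card : ℝ) := by
          refine Finset.sum_le_sum fun v _ => ?_
          by_cases hv : θ ≤ |bias (u + v)|
          · simpa only [hv, true_and] using card_against_drift_le hn hm hε hθ0 hΩ hA hv
          · simp only [hv, false_and, Finset.filter_false, Finset.card_empty, Nat.cast_zero]
            positivity
      _ = ε * C.card * Ω.card := by simp; ring
  have hQ := card_le_two_mul_of_reverse ((stayPairs C Ω).filter (fun p => θ ≤ |bias (u + p.1)| ∧
      θ ≤ |bias (u + p.1 + entryVec p.2)|)) T reversePair reversePair_reversePair ?_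
  · have : (((stayPairs C Ω).filter (fun p => θ ≤ |bias (u + p.1)| ∧
      θ ≤ |bias (u + p.1 + entryVec p.2)|)).card : ℝ) ≤ 2 * T.card := by exact_mod_cast hQ
    linarith
  · rintro ⟨v, ω⟩ hp
    obtain ⟨hp, h1, h2⟩ := Finset.mem_filter.1 hp
    obtain ⟨hv, hω, hvω⟩ := mem_stayPairs.1 hp
    simp only at h1 h2 hv hω hvω
    by_contra hcon
    push Not at hcon
    obtain ⟨c1, c2⟩ := hcon
    have d1 : 0 < bias (u + v) * tupleSum (signVec (u + v)) ω := by
      by_contra hneg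
      exact c1 (Finset.mem_filter.2 ⟨Finset.mk_mem_product hv hω, h1, not_lt.1 hneg⟩)
    have d2 : 0 < bias (u + v + entryVec ω) * tupleSum (signVec (u + v + entryVec ω)) ω := by
      by_contra hneg
      refine c2 (Finset.mem_filter.2 ⟨Finset.mk_mem_product hvω hω, ?_, ?_⟩)
      · simpa only [reversePair, ← add_assoc] using h2
      · simpa only [reversePair, ← add_assoc] using not_lt.1 hneg
    -- Since `2 m ≤ θ`, the step cannot change the sign of the bias, whereas it negates the sum of
    -- the signs along `ω`; hence it follows the drift in one direction only.
    rw [tupleSum_add_entryVec] at d2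
    have hb := bias_add_entryVec (u + v) (hinj ω hω)
    have hS := abs_le.1 (abs_tupleSum_signVec_le (u + v) ω)
    rw [hb] at d2 h2
    set b := bias (u + v)
    set S := tupleSum (signVec (u + v)) ω
    rcases pos_and_pos_or_neg_and_neg_of_mul_pos d1 with ⟨hb0, hS0⟩ | ⟨hb0, hS0⟩
    · rw [abs_of_pos hb0] at h1
      nlinarith [mul_nonneg (show 0 ≤ b - 2 * S by linarith) hS0.le]
    · rw [abs_of_neg hb0] at h1
      nlinarith [mul_nonneg (show 0 ≤ -(b - 2 * S) by linarith) (show 0 ≤ -S by linarith)]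

/-- The points of `C` from which at least half of the steps stay in `C`. -/
noncomputable def stayCore {n m : ℕ} (C : Finset (Fin n → ZMod 2)) (Ω : Finset (Fin m → Fin n)) :
    Finset (Fin n → ZMod 2) :=
  C.filter (fun v => (Ω.card : ℝ) / 2 ≤ (Ω.filter (fun ω => v + entryVec ω ∈ C)).card)

lemma card_stayPairs {n m : ℕ} (C : Finset (Fin n → ZMod 2)) (Ω : Finset (Fin m → Fin n)) :
    ((stayPairs C Ω).card : ℝ) =
      ∑ v ∈ C, ((Ω.filter (fun ω => v + entryVec ω ∈ C)).card : ℝ) := by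
  rw [stayPairs, card_filter_product_eq_sum]
  push_cast
  rfl

/-- Markov's inequality for the number of steps leaving `C`. -/
lemma card_sub_card_stayCore_le {n m : ℕ} {C : Finset (Fin n → ZMod 2)}
    {Ω : Finset (Fin m → Fin n)} (hΩ0 : Ω.Nonempty)
    (hstay : 99 / 100 * (C.card : ℝ) * Ω.card ≤ (stayPairs C Ω).card) :
    (C.card : ℝ) - (stayCore C Ω).card ≤ C.card / 50 := by
  have hpos : (0 : ℝ) < Ω.card := by exact_mod_cast hΩ0.card_pos
  have h1 : ((stayPairs C Ω).card : ℝ) ≤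
      ∑ v ∈ C, (Ω.card / 2 + if v ∈ stayCore C Ω then (Ω.card : ℝ) / 2 else 0) := by
    rw [card_stayPairs]
    refine Finset.sum_le_sum fun v hv => ?_
    split_ifs with h
    · have : ((Ω.filter (fun ω => v + entryVec ω ∈ C)).card : ℝ) ≤ Ω.card := by
        exact_mod_cast Finset.card_filter_le _ _
      linarith
    · have : ¬ ((Ω.card : ℝ) / 2 ≤ (Ω.filter (fun ω => v + entryVec ω ∈ C)).card) :=
        fun h' => h (Finset.mem_filter.2 ⟨hv, h'⟩)
      linarith [not_le.1 this]
  have h2 : ∑ v ∈ C, (if v ∈ stayCore C Ω then (Ω.card : ℝ) / 2 else 0) =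
      (stayCore C Ω).card * (Ω.card / 2) := by
    rw [Finset.sum_ite_mem, Finset.inter_eq_right.2 (show stayCore C Ω ⊆ C from
      Finset.filter_subset _ _)]
    simp
  rw [Finset.sum_add_distrib, h2] at h1
  simp only [Finset.sum_const, nsmul_eq_mul] at h1
  have h3 : ((C.card : ℝ) - (stayCore C Ω).card) * Ω.card ≤ C.card / 50 * Ω.card := by
    linarith
  exact le_of_mul_le_mul_right h3 hpos

/-- Hardly any point of the core of `C` is strongly correlated with a given `u`. -/
lemma card_stayCore_biased_le {n m : ℕ} (hn : 0 < n) (hm : 0 < m)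
    {C : Finset (Fin n → ZMod 2)} {Ω : Finset (Fin m → Fin n)}
    (hinj : ∀ ω ∈ Ω, Function.Injective ω) {δ ε θ : ℝ} (hδ : 0 < δ) (hε : 0 ≤ ε)
    (hθ : 2 * (m : ℝ) ≤ θ) (hΩ : δ * (n : ℝ) ^ m ≤ Ω.card)
    (hA : (n : ℝ) ^ 2 ≤ ε * δ * m * θ ^ 2) (u : Fin n → ZMod 2) :
    (((stayCore C Ω).filter (fun v => 2 * θ ≤ |bias (u + v)|)).card : ℝ) ≤ 4 * ε * C.card := by
  have hn' : (0 : ℝ) < n := by exact_mod_cast hn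
  have hpos : (0 : ℝ) < Ω.card := lt_of_lt_of_le (by positivity) hΩ
  have hQ := card_stayPairs_biased_le (C := C) hn hm hinj hε hθ hΩ hA u
  set D := (stayCore C Ω).filter (fun v => 2 * θ ≤ |bias (u + v)|) with hD
  have h1 : (D.card : ℝ) * (Ω.card / 2) ≤
      (((stayPairs C Ω).filter (fun p => θ ≤ |bias (u + p.1)| ∧
      θ ≤ |bias (u + p.1 + entryVec p.2)|)).card : ℝ) := by
    calc (D.card : ℝ) * (Ω.card / 2) = ∑ v ∈ D, (Ω.card : ℝ) / 2 := by simp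
      _ ≤ ∑ v ∈ D, ((Ω.filter (fun ω => v + entryVec ω ∈ C)).card : ℝ) :=
          Finset.sum_le_sum fun v hv =>
            (Finset.mem_filter.1 (Finset.mem_filter.1 hv).1).2
      _ = (((D ×ˢ Ω).filter (fun p => p.1 + entryVec p.2 ∈ C)).card : ℝ) := by
          rw [card_filter_product_eq_sum]; push_cast; rfl
      _ ≤ _ := by
          refine Nat.cast_le.2 (Finset.card_le_card ?_)
          rintro ⟨v, ω⟩ hp
          obtain ⟨hp, hC⟩ := Finset.mem_filter.1 hp
          obtain ⟨hv, hω⟩ := Finset.mem_product.1 hp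
          simp only at hv hω hC
          obtain ⟨hv, hb⟩ := Finset.mem_filter.1 hv
          have hm' : (0 : ℝ) < m := by exact_mod_cast hm
          refine Finset.mem_filter.2 ⟨mem_stayPairs.2 ⟨(Finset.mem_filter.1 hv).1, hω, hC⟩, ?_, ?_⟩
          · simp only; linarith
          · simp only
            rw [bias_add_entryVec _ (hinj ω hω)]
            have hS := abs_tupleSum_signVec_le (u + v) ω
            have := abs_sub_abs_le_abs_sub (bias (u + v)) (2 * tupleSum (signVec (u + v)) ω)
            rw [abs_mul, abs_two] at this
            linarith
  have h2 : (D.card : ℝ) * Ω.card ≤ 4 * ε * C.card * Ω.card := by linarith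
  exact le_of_mul_le_mul_right h2 hpos

/-- Reversing a step negates its effect on the weight, so at least half of the staying steps do not
increase the weight; all but few of them start in the core. -/
lemma card_nonincreasing_steps_ge {n m : ℕ} {C : Finset (Fin n → ZMod 2)}
    {Ω : Finset (Fin m → Fin n)} (hΩ0 : Ω.Nonempty)
    (hstay : 99 / 100 * (C.card : ℝ) * Ω.card ≤ (stayPairs C Ω).card) :
    2 / 5 * (C.card : ℝ) * Ω.card ≤
      (((stayCore C Ω) ×ˢ Ω).filter (fun p => tupleSum (signVec p.1) p.2 ≤ 0)).card := by
  have hcore := card_sub_card_stayCore_le hΩ0 hstay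
  have h1 := card_le_two_mul_of_reverse (stayPairs C Ω)
    ((C ×ˢ Ω).filter (fun p => tupleSum (signVec p.1) p.2 ≤ 0)) reversePair
    reversePair_reversePair ?_
  · have h2 : ((C ×ˢ Ω).filter (fun p => tupleSum (signVec p.1) p.2 ≤ 0)) ⊆
        ((stayCore C Ω) ×ˢ Ω).filter (fun p => tupleSum (signVec p.1) p.2 ≤ 0) ∪
        (C \ stayCore C Ω) ×ˢ Ω := by
      rintro ⟨v, ω⟩ hp
      simp only [Finset.mem_filter, Finset.mem_product, Finset.mem_union,
        Finset.mem_sdiff] at hp ⊢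
      tauto
    have h3 := (Finset.card_le_card h2).trans (Finset.card_union_le _ _)
    rw [Finset.card_product (C \ stayCore C Ω)] at h3
    have h4 : ((C \ stayCore C Ω).card : ℝ) = C.card - (stayCore C Ω).card :=
      Finset.cast_card_sdiff (Finset.filter_subset _ _)
    have h1' : ((stayPairs C Ω).card : ℝ) ≤
        2 * (((C ×ˢ Ω).filter (fun p => tupleSum (signVec p.1) p.2 ≤ 0)).card : ℝ) := by
      exact_mod_cast h1
    have h3' : (((C ×ˢ Ω).filter (fun p => tupleSum (signVec p.1) p.2 ≤ 0)).card : ℝ) ≤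
        (((stayCore C Ω) ×ˢ Ω).filter (fun p => tupleSum (signVec p.1) p.2 ≤ 0)).card +
        ((C \ stayCore C Ω).card : ℝ) * Ω.card := by exact_mod_cast h3
    rw [h4] at h3'
    have h5 : ((C.card : ℝ) - (stayCore C Ω).card) * Ω.card ≤ C.card / 50 * Ω.card :=
      mul_le_mul_of_nonneg_right hcore (Nat.cast_nonneg _)
    have h6 : (0 : ℝ) ≤ C.card * Ω.card := by positivity
    linarith
  · rintro ⟨v, ω⟩ hp
    obtain ⟨hv, hω, hvω⟩ := mem_stayPairs.1 hp
    simp only at hv hω hvω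
    rcases le_total (tupleSum (signVec v) ω) 0 with h | h
    · exact Or.inl (Finset.mem_filter.2 ⟨Finset.mk_mem_product hv hω, h⟩)
    · refine Or.inr (Finset.mem_filter.2 ⟨Finset.mk_mem_product hvω hω, ?_⟩)
      simp only [reversePair, tupleSum_add_entryVec]
      linarith

/-! ### Quadratic concentration on dense sets of tuples -/

/-- The deviation of the squared centred sum of signs along a tuple from its mean. -/
noncomputable def quadDev {n m : ℕ} (v : Fin n → ZMod 2) (ω : Fin m → Fin n) : ℝ :=
  tupleSum (centre (signVec v)) ω ^ 2 - m * (1 - (bias v / n) ^ 2)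

/-- The covariance, over a uniform coordinate, of the signs of `v` and `w`. -/
noncomputable def signCov {n : ℕ} (v w : Fin n → ZMod 2) : ℝ :=
  bias (v + w) / n - bias v / n * (bias w / n)

lemma sum_centre_signVec_mul {n : ℕ} (hn : 0 < n) (v w : Fin n → ZMod 2) :
    ∑ i, centre (signVec v) i * centre (signVec w) i = n * signCov v w := by
  rw [sum_centre_mul hn]
  simp only [← signVec_add]
  rfl

lemma signCov_self {n : ℕ} (hn : 0 < n) (v : Fin n → ZMod 2) :
    signCov v v = 1 - (bias v / n) ^ 2 := by
  have : (n : ℝ) ≠ 0 := by positivity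
  have hvv : bias (v + v) = n := by
    simp [bias, signVec_add, signVec_mul_self]
  rw [signCov, hvv, div_self this]
  ring

lemma signCov_self_nonneg {n : ℕ} (hn : 0 < n) (v : Fin n → ZMod 2) : 0 ≤ signCov v v := by
  have hn' : (0 : ℝ) < n := by exact_mod_cast hn
  have h := sum_centre_signVec_mul hn v v
  have h0 : 0 ≤ ∑ i, centre (signVec v) i * centre (signVec v) i :=
    Finset.sum_nonneg fun i _ => mul_self_nonneg _
  rw [h] at h0
  exact nonneg_of_mul_nonneg_right h0 hn'

lemma abs_bias_div_le_one {n : ℕ} (v : Fin n → ZMod 2) : |bias v / n| ≤ 1 := by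
  rw [abs_div, Nat.abs_cast]
  exact div_le_one_of_le₀ (abs_bias_le v) (Nat.cast_nonneg _)

lemma sq_centre_signVec_le {n : ℕ} (v : Fin n → ZMod 2) (i : Fin n) :
    centre (signVec v) i ^ 2 ≤ 4 := by
  have h1 := abs_le.1 (abs_signVec v i).le
  have h2 := abs_le.1 (abs_bias_div_le_one v)
  have e : centre (signVec v) i = signVec v i - bias v / n := rfl
  rw [e]
  nlinarith

/-- The squares of two centred sums of signs are nearly uncorrelated when the signs are. -/
lemma sum_quadDev_mul_le {n : ℕ} (hn : 0 < n) (v w : Fin n → ZMod 2) (m : ℕ) :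
    ∑ ω : Fin m → Fin n, quadDev v ω * quadDev w ω ≤
      (n : ℝ) ^ m * (16 * m + 2 * m ^ 2 * signCov v w ^ 2) := by
  have hn' : (0 : ℝ) < n := by exact_mod_cast hn
  set y := centre (signVec v) with hy
  set z := centre (signVec w) with hz
  set q : ℝ := (∑ i, y i ^ 2 * z i ^ 2) / n with hq
  have hqn : ∑ i, y i ^ 2 * z i ^ 2 = n * q := by rw [hq]; field_simp
  have hq16 : q ≤ 16 := by
    rw [hq, div_le_iff₀ hn']
    calc ∑ i, y i ^ 2 * z i ^ 2 ≤ ∑ _i : Fin n, (16 : ℝ) := by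
          refine Finset.sum_le_sum fun i _ => ?_
          have h1 := sq_centre_signVec_le v i
          have h2 := sq_centre_signVec_le w i
          nlinarith [sq_nonneg (centre (signVec v) i), sq_nonneg (centre (signVec w) i)]
      _ = 16 * n := by simp; ring
  have hyy := sum_tupleSum_mul y y (sum_centre hn _) (sum_centre hn _)
    (sum_centre_signVec_mul hn v v) m
  have hzz := sum_tupleSum_mul z z (sum_centre hn _) (sum_centre hn _)
    (sum_centre_signVec_mul hn w w) m
  have h4 := sum_tupleSum_sq_mul_sq y z (sum_centre hn _) (sum_centre hn _)
    (sum_centre_signVec_mul hn v v) (sum_centre_signVec_mul hn w w)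
    (sum_centre_signVec_mul hn v w) hqn m
  have hσ := signCov_self_nonneg hn v
  have hτ := signCov_self_nonneg hn w
  set σ := signCov v v with hσdef
  set τ := signCov w w with hτdef
  have hexp : ∀ ω : Fin m → Fin n, quadDev v ω * quadDev w ω =
      tupleSum y ω ^ 2 * tupleSum z ω ^ 2 - m * σ * (tupleSum z ω * tupleSum z ω) -
      m * τ * (tupleSum y ω * tupleSum y ω) + (m * σ) * (m * τ) * 1 := by
    intro ω
    rw [quadDev, quadDev, ← signCov_self hn, ← signCov_self hn]
    ring
  simp only [hexp, Finset.sum_add_distrib, Finset.sum_sub_distrib, ← Finset.mul_sum, hyy, hzz, h4,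
    sum_tuple_one]
  have hm : (0 : ℝ) ≤ m := Nat.cast_nonneg _
  have hn0 : (0 : ℝ) ≤ (n : ℝ) ^ m := by positivity
  have e : (n : ℝ) ^ m * (m * q + m * (m - 1) * (σ * τ + 2 * signCov v w ^ 2)) -
      m * σ * ((n : ℝ) ^ m * (m * τ)) - m * τ * ((n : ℝ) ^ m * (m * σ)) +
      m * σ * (m * τ) * (n : ℝ) ^ m =
      (n : ℝ) ^ m * (m * q + 2 * m ^ 2 * signCov v w ^ 2 - m * (σ * τ) -
        2 * (m * signCov v w ^ 2)) := by ring
  rw [e]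
  refine mul_le_mul_of_nonneg_left ?_ hn0
  have h1 := mul_le_mul_of_nonneg_left hq16 hm
  have h2 := mul_nonneg hm (mul_nonneg hσ hτ)
  have h3 := mul_nonneg hm (sq_nonneg (signCov v w))
  linarith

/-- The covariance of the signs is small unless `v` correlates with `0` or with `w`; the indicators
for both events are kept in the form `bias (u + ·)`. -/
lemma sq_signCov_le {n : ℕ} (hn : 0 < n) (v w : Fin n → ZMod 2) (θ : ℝ) :
    signCov v w ^ 2 ≤ 16 * θ ^ 2 / n ^ 2 + ((if 2 * θ ≤ |bias (0 + v)| then 4 else 0) +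
      if 2 * θ ≤ |bias (v + w)| then 4 else 0) := by
  have hn' : (0 : ℝ) < n := by exact_mod_cast hn
  rw [zero_add]
  have hp := abs_bias_div_le_one (v + w)
  have ha := abs_bias_div_le_one v
  have hb := abs_bias_div_le_one w
  have habs : |signCov v w| ≤ |bias (v + w) / n| + |bias v / n| := by
    refine (abs_sub _ _).trans ?_
    rw [abs_mul (bias v / n)]
    have := mul_le_mul_of_nonneg_left hb (abs_nonneg (bias v / n))
    linarith
  have h0 : 0 ≤ 16 * θ ^ 2 / (n : ℝ) ^ 2 := by positivity
  have h4 : signCov v w ^ 2 ≤ 4 := by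
    rw [← sq_abs]; nlinarith [abs_nonneg (signCov v w)]
  split_ifs with h1 h2 h2
  · linarith
  · linarith
  · linarith
  · push Not at h1 h2
    have h5 : |signCov v w| ≤ 4 * θ / n := by
      refine habs.trans ?_
      rw [abs_div, abs_div, Nat.abs_cast, ← add_div]
      gcongr
      linarith
    rw [← sq_abs]
    calc |signCov v w| ^ 2 ≤ (4 * θ / n) ^ 2 := by gcongr
      _ = _ := by ring

/-- On a dense set of tuples, the average squared centred sum of signs, taken over a family of
vectors that are mostly nearly uncorrelated, is at most twice its typical size `m`. -/
lemma sum_sq_tupleSum_le {n m : ℕ} (hn : 0 < n) (hm : 0 < m) (D : Finset (Fin n → ZMod 2))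
    (Ω : Finset (Fin m → Fin n)) {M δ ε θ : ℝ}
    (hΩ : δ * (n : ℝ) ^ m ≤ Ω.card) (hDM : (D.card : ℝ) ≤ M)
    (hcorr : ∀ u, ((D.filter (fun v => 2 * θ ≤ |bias (u + v)|)).card : ℝ) ≤ 4 * ε * M)
    (hsmall : 16 / (m : ℝ) + 64 * ε + 32 * θ ^ 2 / n ^ 2 ≤ δ) :
    ∑ v ∈ D, ∑ ω ∈ Ω, tupleSum (centre (signVec v)) ω ^ 2 ≤ 2 * m * M * Ω.card := by
  have hn' : (0 : ℝ) < n := by exact_mod_cast hn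
  have hm' : (0 : ℝ) < m := by exact_mod_cast hm
  have hM : 0 ≤ M := (Nat.cast_nonneg _).trans hDM
  have hεM : 0 ≤ 4 * ε * M := (Nat.cast_nonneg _).trans (hcorr 0)
  have hcov : ∑ v ∈ D, ∑ w ∈ D, signCov v w ^ 2 ≤
      M ^ 2 * (16 * θ ^ 2 / n ^ 2 + 32 * ε) := by
    have step : ∀ v ∈ D, ∑ w ∈ D, signCov v w ^ 2 ≤
        M * (16 * θ ^ 2 / n ^ 2) + M * (if 2 * θ ≤ |bias (0 + v)| then 4 else 0) +
          4 * (4 * ε * M) := by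
      intro v _
      refine (Finset.sum_le_sum fun w _ => sq_signCov_le hn v w θ).trans ?_
      rw [Finset.sum_add_distrib, Finset.sum_add_distrib, Finset.sum_const, Finset.sum_const,
        ← Finset.sum_filter, Finset.sum_const, nsmul_eq_mul, nsmul_eq_mul, nsmul_eq_mul]
      have h1 := mul_le_mul_of_nonneg_right hDM
        (show 0 ≤ 16 * θ ^ 2 / (n : ℝ) ^ 2 by positivity)
      have h2 := mul_le_mul_of_nonneg_right hDM
        (show (0 : ℝ) ≤ (if 2 * θ ≤ |bias (0 + v)| then 4 else 0) by split_ifs <;> norm_num)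
      have h3 := hcorr v
      linarith
    refine (Finset.sum_le_sum step).trans ?_
    rw [Finset.sum_add_distrib, Finset.sum_add_distrib, Finset.sum_const, Finset.sum_const,
      ← Finset.mul_sum, ← Finset.sum_filter, Finset.sum_const, nsmul_eq_mul, nsmul_eq_mul,
      nsmul_eq_mul]
    have h1 := mul_le_mul_of_nonneg_right hDM
      (show 0 ≤ M * (16 * θ ^ 2 / (n : ℝ) ^ 2) by positivity)
    have h2 := mul_le_mul_of_nonneg_left (hcorr 0) hM
    have h3 := mul_le_mul_of_nonneg_right hDM hεM
    nlinarith
  set G : (Fin m → Fin n) → ℝ := fun ω => ∑ v ∈ D, quadDev v ω with hG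
  have hGsq : ∑ ω, G ω ^ 2 ≤ (n : ℝ) ^ m * (M ^ 2 * m ^ 2 * δ) := by
    calc ∑ ω, G ω ^ 2 = ∑ v ∈ D, ∑ w ∈ D, ∑ ω : Fin m → Fin n, quadDev v ω * quadDev w ω := by
          simp only [hG, pow_two, Finset.sum_mul_sum]
          rw [Finset.sum_comm]
          refine Finset.sum_congr rfl fun v _ => Finset.sum_comm
      _ ≤ ∑ v ∈ D, ∑ w ∈ D, (n : ℝ) ^ m * (16 * m + 2 * m ^ 2 * signCov v w ^ 2) :=
          Finset.sum_le_sum fun v _ => Finset.sum_le_sum fun w _ => sum_quadDev_mul_le hn v w m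
      _ = (n : ℝ) ^ m * (D.card * D.card * (16 * m) +
            2 * m ^ 2 * ∑ v ∈ D, ∑ w ∈ D, signCov v w ^ 2) := by
          simp only [← Finset.mul_sum, Finset.sum_add_distrib, Finset.sum_const, nsmul_eq_mul]
          ring
      _ ≤ (n : ℝ) ^ m * (M * M * (16 * m) +
            2 * m ^ 2 * (M ^ 2 * (16 * θ ^ 2 / n ^ 2 + 32 * ε))) := by gcongr
      _ = (n : ℝ) ^ m * (M ^ 2 * m ^ 2 * (16 / (m : ℝ) + 64 * ε + 32 * θ ^ 2 / n ^ 2)) := by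
          field_simp
          ring
      _ ≤ _ := by gcongr
  -- Cauchy-Schwarz on `Ω`; passing to all tuples loses the density `δ`, which the small covariance
  -- compensates.
  have hCS : (∑ ω ∈ Ω, G ω) ^ 2 ≤ (m * M * Ω.card) ^ 2 := by
    calc (∑ ω ∈ Ω, G ω) ^ 2 ≤ Ω.card * ∑ ω ∈ Ω, G ω ^ 2 := sq_sum_le_card_mul_sum_sq
      _ ≤ Ω.card * ∑ ω, G ω ^ 2 := by
          gcongr
          exact Finset.subset_univ _
      _ ≤ Ω.card * ((n : ℝ) ^ m * (M ^ 2 * m ^ 2 * δ)) := by gcongr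
      _ = Ω.card * M ^ 2 * m ^ 2 * (δ * (n : ℝ) ^ m) := by ring
      _ ≤ Ω.card * M ^ 2 * m ^ 2 * Ω.card := by gcongr
      _ = _ := by ring
  have hsum : ∑ ω ∈ Ω, G ω ≤ m * M * Ω.card := le_of_sq_le_sq hCS (by positivity)
  have hsplit : ∑ v ∈ D, ∑ ω ∈ Ω, tupleSum (centre (signVec v)) ω ^ 2 ≤
      ∑ ω ∈ Ω, G ω + m * D.card * Ω.card := by
    rw [hG, Finset.sum_comm (s := Ω)]
    have : ∀ v ∈ D, ∑ ω ∈ Ω, tupleSum (centre (signVec v)) ω ^ 2 ≤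
        ∑ ω ∈ Ω, quadDev v ω + m * Ω.card := by
      intro v _
      have h : ∀ ω ∈ Ω, tupleSum (centre (signVec v)) ω ^ 2 ≤ quadDev v ω + m := by
        intro ω _
        rw [quadDev]
        nlinarith [sq_nonneg (bias v / n)]
      refine (Finset.sum_le_sum h).trans ?_
      rw [Finset.sum_add_distrib, Finset.sum_const, nsmul_eq_mul]
      linarith
    refine (Finset.sum_le_sum this).trans ?_
    rw [Finset.sum_add_distrib, Finset.sum_const, nsmul_eq_mul]
    linarith
  have : m * D.card * Ω.card ≤ m * M * Ω.card := by gcongr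
  linarith

/-- A set of vectors whose bias exceeds several standard deviations of a step is not almost closed
under a dense set of steps, once the parameters are in the right range. -/
lemma not_almost_closed {n m : ℕ} (hn : 0 < n) (hm : 0 < m) {C : Finset (Fin n → ZMod 2)}
    {Ω : Finset (Fin m → Fin n)} (hC : C.Nonempty) (hinj : ∀ ω ∈ Ω, Function.Injective ω)
    {δ ε θ : ℝ} (hδ : 0 < δ) (hε : 0 ≤ ε) (hθ : 2 * (m : ℝ) ≤ θ)
    (hΩ : δ * (n : ℝ) ^ m ≤ Ω.card) (hA : (n : ℝ) ^ 2 ≤ ε * δ * m * θ ^ 2)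
    (hsmall : 16 / (m : ℝ) + 64 * ε + 32 * θ ^ 2 / n ^ 2 ≤ δ)
    (hbias : ∀ v ∈ C, 0 < bias v ∧ 25 * (n : ℝ) ^ 2 ≤ m * bias v ^ 2) :
    ¬ 99 / 100 * (C.card : ℝ) * Ω.card ≤ (stayPairs C Ω).card := by
  intro hstay
  have hn' : (0 : ℝ) < n := by exact_mod_cast hn
  have hm' : (0 : ℝ) < m := by exact_mod_cast hm
  have hΩpos : (0 : ℝ) < Ω.card := lt_of_lt_of_le (by positivity) hΩ
  have hΩ0 : Ω.Nonempty := Finset.card_pos.1 (by exact_mod_cast hΩpos)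
  have hCpos : (0 : ℝ) < C.card := by exact_mod_cast hC.card_pos
  have hsub : stayCore C Ω ⊆ C := Finset.filter_subset _ _
  have hup := sum_sq_tupleSum_le hn hm (stayCore C Ω) Ω hΩ
    (Nat.cast_le.2 (Finset.card_le_card hsub))
    (card_stayCore_biased_le hn hm hinj hδ hε hθ hΩ hA) hsmall
  have hlow := card_nonincreasing_steps_ge hΩ0 hstay
  rw [← Finset.sum_product'] at hup
  have h1 : ((((stayCore C Ω) ×ˢ Ω).filter
      (fun p => tupleSum (signVec p.1) p.2 ≤ 0)).card : ℝ) * (25 * m) ≤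
      ∑ p ∈ (stayCore C Ω) ×ˢ Ω, tupleSum (centre (signVec p.1)) p.2 ^ 2 := by
    suffices hcard : ∀ p ∈ ((stayCore C Ω) ×ˢ Ω).filter
        (fun p => tupleSum (signVec p.1) p.2 ≤ 0),
        25 * (m : ℝ) ≤ tupleSum (centre (signVec p.1)) p.2 ^ 2 by
      rw [← nsmul_eq_mul]
      exact (Finset.card_nsmul_le_sum _ _ _ hcard).trans
        (Finset.sum_le_sum_of_subset_of_nonneg (Finset.filter_subset _ _)
          fun _ _ _ => sq_nonneg _)
    rintro ⟨v, ω⟩ hp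
    obtain ⟨hp, hS⟩ := Finset.mem_filter.1 hp
    obtain ⟨hb, hb2⟩ := hbias v (hsub (Finset.mem_product.1 hp).1)
    simp only at hS ⊢
    have e : tupleSum (centre (signVec v)) ω =
      -(-tupleSum (signVec v) ω + m * (bias v / n)) := by
      rw [tupleSum_centre]
      simp only [bias]
      ring
    have h2 : 0 ≤ m * (bias v / n) := by positivity
    calc 25 * (m : ℝ) ≤ (m * (bias v / n)) ^ 2 := by
          have : (m * (bias v / n)) ^ 2 = m * (m * bias v ^ 2) / n ^ 2 := by ring
          rw [this, le_div_iff₀ (by positivity)]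
          have := mul_le_mul_of_nonneg_left hb2 hm'.le
          linarith
      _ ≤ _ := by
          rw [e, neg_sq]
          gcongr
          linarith
  have h2 : 2 / 5 * (C.card : ℝ) * Ω.card * (25 * m) ≤ 2 * m * C.card * Ω.card :=
    (mul_le_mul_of_nonneg_right hlow (by positivity)).trans (h1.trans hup)
  have h3 : 0 < (m : ℝ) * C.card * Ω.card := by positivity
  linarith

/-! ### Sampling a layer of the cube by injective tuples -/

/-- The layer of the cube formed by the vectors of weight `k`. -/
def cubeLayer (n k : ℕ) : Finset (Fin n → ZMod 2) :=
  Finset.univ.filter (fun v => hammingNorm v = k)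

lemma mem_cubeLayer {n k : ℕ} {v : Fin n → ZMod 2} : v ∈ cubeLayer n k ↔ hammingNorm v = k := by
  simp [cubeLayer]

/-- The injective tuples whose set of entries belongs to `B`. -/
def stepTuples {n : ℕ} (m : ℕ) (B : Finset (Fin n → ZMod 2)) : Finset (Fin m → Fin n) :=
  Finset.univ.filter (fun ω => Function.Injective ω ∧ entryVec ω ∈ B)

lemma mem_stepTuples {n m : ℕ} {B : Finset (Fin n → ZMod 2)} {ω : Fin m → Fin n} :
    ω ∈ stepTuples m B ↔ Function.Injective ω ∧ entryVec ω ∈ B := by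
  simp [stepTuples]

lemma entryVec_ne_zero_iff {n m : ℕ} (ω : Fin m → Fin n) (i : Fin n) :
    entryVec ω i ≠ 0 ↔ ∃ j, ω j = i := by
  simp [entryVec]

lemma hammingNorm_entryVec {n m : ℕ} {ω : Fin m → Fin n} (hω : Function.Injective ω) :
    hammingNorm (entryVec ω) = m := by
  have : (Finset.univ.filter fun i => entryVec ω i ≠ 0) = Finset.univ.image ω := by
    ext i; simp [entryVec_ne_zero_iff]
  rw [hammingNorm, this, Finset.card_image_of_injective _ hω, Finset.card_univ, Fintype.card_fin]

/-- Each vector of weight `m` arises from `m!` injective tuples, so uniform injective tuples sample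
the layer uniformly. -/
lemma card_entryVec_fibre {n m : ℕ} {b : Fin n → ZMod 2} (hb : b ∈ cubeLayer n m) :
    (Finset.univ.filter (fun ω : Fin m → Fin n => Function.Injective ω ∧ entryVec ω = b)).card =
      m.factorial := by
  have hcard : Fintype.card {i // b i ≠ 0} = m := by
    rw [Fintype.card_subtype]; exact mem_cubeLayer.1 hb
  have hemb : (Finset.univ : Finset (Fin m ↪ {i // b i ≠ 0})).card = m.factorial := by
    rw [Finset.card_univ, Fintype.card_embedding_eq, hcard, Fintype.card_fin, Nat.descFactorial_self]
  rw [← hemb]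
  symm
  refine Finset.card_bij (fun e _ j => (e j).1) ?_ ?_ ?_
  · intro e _
    refine Finset.mem_filter.2 ⟨Finset.mem_univ _, fun a c h => e.injective (Subtype.ext h), ?_⟩
    have hsurj : Function.Surjective e :=
      ((Fintype.bijective_iff_injective_and_card e).2 ⟨e.injective, by simp [hcard]⟩).2
    funext i
    have h1 : ∀ x : ZMod 2, x ≠ 0 → x = 1 := by decide
    by_cases hi : b i = 0
    · rw [hi]
      by_contra hne
      obtain ⟨j, hj⟩ := (entryVec_ne_zero_iff _ i).1 hne
      exact (e j).2 (by rw [hj, hi])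
    · obtain ⟨j, hj⟩ := hsurj ⟨i, hi⟩
      rw [h1 _ hi, h1 _ ((entryVec_ne_zero_iff _ i).2 ⟨j, by rw [hj]⟩)]
  · intro e _ e' _ h
    ext j
    exact congrArg Fin.val (congrFun h j)
  · intro ω hω
    obtain ⟨-, hinj, hb'⟩ := Finset.mem_filter.1 hω
    refine ⟨⟨fun j => ⟨ω j, ?_⟩, fun a c h => hinj (congrArg Subtype.val h)⟩,
      Finset.mem_univ _, rfl⟩
    rw [← hb']
    exact (entryVec_ne_zero_iff _ _).2 ⟨j, rfl⟩

lemma card_stepTuples {n m : ℕ} {B : Finset (Fin n → ZMod 2)} (hB : B ⊆ cubeLayer n m) :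
    (stepTuples m B).card = m.factorial * B.card := by
  rw [Finset.card_eq_sum_card_fiberwise (f := entryVec) (t := B)
    (fun ω hω => (mem_stepTuples.1 hω).2)]
  rw [mul_comm, ← smul_eq_mul, ← Finset.sum_const]
  refine Finset.sum_congr rfl fun b hb => ?_
  rw [← card_entryVec_fibre (hB hb)]
  congr 1
  ext ω
  simp only [Finset.mem_filter, mem_stepTuples, Finset.mem_univ, true_and]
  constructor
  · rintro ⟨⟨h1, -⟩, h2⟩; exact ⟨h1, h2⟩
  · rintro ⟨h1, h2⟩; exact ⟨⟨h1, h2 ▸ hb⟩, h2⟩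

lemma card_stepTuples_cubeLayer (n m : ℕ) :
    (stepTuples m (cubeLayer n m)).card = n.descFactorial m := by
  have h : n.descFactorial m = Fintype.card (Fin m ↪ Fin n) := by
    simp [Fintype.card_embedding_eq]
  rw [h, ← Finset.card_univ]
  symm
  refine Finset.card_bij (fun e _ => ⇑e) ?_ ?_ ?_
  · intro e _
    exact mem_stepTuples.2 ⟨e.injective, mem_cubeLayer.2 (hammingNorm_entryVec e.injective)⟩
  · intro e _ e' _ h
    exact DFunLike.coe_injective h
  · intro ω hω
    exact ⟨⟨ω, (mem_stepTuples.1 hω).1⟩, Finset.mem_univ _, rfl⟩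

lemma card_cubeLayer (n k : ℕ) : (cubeLayer n k).card = n.choose k := by
  have h1 := card_stepTuples (subset_refl (cubeLayer n k))
  rw [card_stepTuples_cubeLayer, Nat.descFactorial_eq_factorial_mul_choose] at h1
  exact (Nat.eq_of_mul_eq_mul_left (Nat.factorial_pos k) h1).symm

/-- A tuple of at most `√n` samples has no repetition with probability at least one half. -/
lemma half_pow_le_descFactorial {n m : ℕ} (h : m ^ 2 ≤ n) :
    (n : ℝ) ^ m / 2 ≤ n.descFactorial m := by
  rcases Nat.eq_zero_or_pos n with rfl | hn
  · have : m = 0 := by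
      by_contra hm
      have := Nat.pos_of_ne_zero hm
      have := pow_pos this 2
      omega
    subst this
    norm_num
  have hn' : (0 : ℝ) < n := by exact_mod_cast hn
  have key : ∀ k ≤ m, (n : ℝ) ^ k * (1 - k ^ 2 / (2 * n)) ≤ n.descFactorial k := by
    intro k
    induction k with
    | zero => simp
    | succ k ih =>
      intro hk
      have hkm : (k + 1) ^ 2 ≤ n := (Nat.pow_le_pow_left hk 2).trans h
      have hkn : k ≤ n := by nlinarith
      have hr : (k : ℝ) ≤ n := by exact_mod_cast hkn
      have ih' := mul_le_mul_of_nonneg_left (ih (by omega)) (sub_nonneg.2 hr)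
      rw [Nat.descFactorial_succ]
      push_cast [Nat.cast_sub hkn]
      refine le_trans ?_ ih'
      have e : ((n : ℝ) - k) * ((n : ℝ) ^ k * (1 - k ^ 2 / (2 * n))) -
          (n : ℝ) ^ (k + 1) * (1 - (k + 1) ^ 2 / (2 * n)) =
          (n : ℝ) ^ k * (1 / 2 + k ^ 3 / (2 * n)) := by
        field_simp
        ring
      have : 0 ≤ (n : ℝ) ^ k * (1 / 2 + k ^ 3 / (2 * n)) := by positivity
      linarith
  refine le_trans ?_ (key m le_rfl)
  have h' : (m : ℝ) ^ 2 ≤ n := by exact_mod_cast h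
  have : (m : ℝ) ^ 2 / (2 * n) ≤ 1 / 2 := by
    rw [div_le_div_iff₀ (by positivity) (by norm_num)]
    linarith
  have h3 : (0 : ℝ) < (n : ℝ) ^ m := by positivity
  nlinarith

lemma filter_stepTuples {n m : ℕ} (B C : Finset (Fin n → ZMod 2)) (v : Fin n → ZMod 2) :
    (stepTuples m B).filter (fun ω => v + entryVec ω ∈ C) =
      stepTuples m (B.filter (fun b => v + b ∈ C)) := by
  ext ω
  simp only [Finset.mem_filter, mem_stepTuples, and_assoc]

lemma card_stayPairs_stepTuples {n m : ℕ} {B : Finset (Fin n → ZMod 2)} (hB : B ⊆ cubeLayer n m)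
    (C : Finset (Fin n → ZMod 2)) :
    (stayPairs C (stepTuples m B)).card =
      m.factorial * ((C ×ˢ B).filter (fun p => p.1 + p.2 ∈ C)).card := by
  rw [stayPairs, card_filter_product_eq_sum, card_filter_product_eq_sum, Finset.mul_sum]
  refine Finset.sum_congr rfl fun v _ => ?_
  simp only
  rw [filter_stepTuples, card_stepTuples ((Finset.filter_subset _ _).trans hB)]

/-! ### Sets below the middle layers that are not almost closed -/

/-- In terms of the fourth root `q` of `n`, all quantities of the problem are polynomial. -/
lemma exists_quarter_root (n : ℕ) : ∃ q : ℝ, 0 ≤ q ∧ q ^ 4 = n ∧ (n : ℝ) ^ (3 / 4 : ℝ) = q ^ 3 ∧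
    (Nat.sqrt n : ℝ) ≤ q ^ 2 ∧ q ^ 2 < Nat.sqrt n + 1 := by
  have hn : (0 : ℝ) ≤ n := Nat.cast_nonneg _
  have h2 : ((n : ℝ) ^ (1 / 4 : ℝ)) ^ 4 = n := by
    rw [← Real.rpow_natCast, ← Real.rpow_mul hn]; norm_num
  refine ⟨(n : ℝ) ^ (1 / 4 : ℝ), by positivity, h2, ?_, ?_, ?_⟩
  · rw [← Real.rpow_natCast, ← Real.rpow_mul hn]; norm_num
  · refine le_of_sq_le_sq ?_ (by positivity)
    rw [← pow_mul, h2]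
    exact_mod_cast Nat.sqrt_le' n
  · refine lt_of_pow_lt_pow_left₀ 2 (by positivity) ?_
    rw [← pow_mul, h2]
    exact_mod_cast Nat.lt_succ_sqrt' n

lemma exists_forall_quarter_root_ge (Q : ℝ) :
    ∃ N : ℕ, ∀ n : ℕ, N ≤ n → ∀ q : ℝ, 0 ≤ q → q ^ 4 = n → Q ≤ q := by
  obtain ⟨N, hN⟩ := exists_nat_ge (Q ^ 4)
  refine ⟨N, fun n hn q hq h => ?_⟩
  refine le_of_pow_le_pow_left₀ (n := 4) (by norm_num) hq ?_
  rw [h]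
  exact hN.trans (by exact_mod_cast hn)

/-- For large `n`, no set of vectors whose bias is at least `10 n ^ (3 / 4)` is almost closed with
respect to a dense part of the layer of weight `⌊√n⌋`. -/
lemma exists_not_almost_closed_of_bias {δ : ℝ} (hδ : 0 < δ) : ∃ Q : ℝ, ∀ (n : ℕ) (q : ℝ),
    0 ≤ q → q ^ 4 = n → Q ≤ q → q ^ 2 < Nat.sqrt n + 1 → (Nat.sqrt n : ℝ) ≤ q ^ 2 →
    ∀ C B : Finset (Fin n → ZMod 2), C.Nonempty → (∀ v ∈ C, 10 * q ^ 3 ≤ bias v) →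
    B ⊆ sqrtLayer n → δ * ((sqrtLayer n).card : ℝ) ≤ B.card → ¬ IsClosedWrt B (99 / 100) C := by
  -- Half of the density is lost to tuples with repetitions. The threshold for strong correlation
  -- is `Θ n ^ (3 / 4)`, with `Θ` so large that Chebyshev's inequality beats the density `d`.
  set d : ℝ := δ / 2 with hd
  have hd0 : 0 < d := by positivity
  set ε : ℝ := d / 200 with hε
  have hε0 : 0 < ε := by positivity
  set Θ : ℝ := 2 / (ε * d) + 2 with hΘ
  have hΘ2 : 2 ≤ Θ := by have : 0 ≤ 2 / (ε * d) := by positivity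
                         linarith
  have hΘ1 : 2 ≤ ε * d * Θ ^ 2 := by
    have h1 : ε * d * Θ = 2 + 2 * (ε * d) := by rw [hΘ]; field_simp
    have h2 : 0 ≤ ε * d := by positivity
    nlinarith
  refine ⟨2 + (32 + 32 * Θ ^ 2) / (d / 2), ?_⟩
  intro n q hq0 hqn hQ hmq hmq' C B hC hbias hB hBcard hclosed
  set m := Nat.sqrt n with hm
  have hQ0 : 0 ≤ (32 + 32 * Θ ^ 2) / (d / 2) := by positivity
  have hq2 : 2 ≤ q := by linarith
  have hqpos : 0 < q := by linarith
  have hmhalf : q ^ 2 / 2 ≤ m := by nlinarith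
  have hm0' : (0 : ℝ) < m := lt_of_lt_of_le (by positivity) hmhalf
  have hm0 : 0 < m := by exact_mod_cast hm0'
  have hn0' : (0 : ℝ) < n := by rw [← hqn]; positivity
  have hn0 : 0 < n := by exact_mod_cast hn0'
  have hBl : B ⊆ cubeLayer n m := hB
  have hfac : (0 : ℝ) < m.factorial := by exact_mod_cast m.factorial_pos
  have hΩ : d * (n : ℝ) ^ m ≤ (stepTuples m B).card := by
    rw [card_stepTuples hBl]
    have h1 := half_pow_le_descFactorial (Nat.sqrt_le' n)
    rw [← hm, ← card_stepTuples_cubeLayer, card_stepTuples (subset_refl _)] at h1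
    have h2 : δ * ((cubeLayer n m).card : ℝ) ≤ B.card := hBcard
    push_cast at h1 ⊢
    calc d * (n : ℝ) ^ m = δ * ((n : ℝ) ^ m / 2) := by rw [hd]; ring
      _ ≤ δ * (m.factorial * (cubeLayer n m).card) := by gcongr
      _ = m.factorial * (δ * (cubeLayer n m).card) := by ring
      _ ≤ _ := by gcongr
  refine not_almost_closed (C := C) (Ω := stepTuples m B) (δ := d) (ε := ε) (θ := Θ * q ^ 3)
    hn0 hm0 hC (fun ω hω => (mem_stepTuples.1 hω).1) hd0 hε0.le ?_ hΩ ?_ ?_ ?_ ?_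
  · have h1 : q ^ 2 ≤ q ^ 3 := pow_le_pow_right₀ (by linarith) (by norm_num)
    have h2 : 2 * q ^ 3 ≤ Θ * q ^ 3 := by gcongr
    linarith
  · calc (n : ℝ) ^ 2 = 2 * (q ^ 2 / 2) * q ^ 6 := by rw [← hqn]; ring
      _ ≤ (ε * d * Θ ^ 2) * m * q ^ 6 := by gcongr
      _ = _ := by ring
  · have h1 : 16 / (m : ℝ) ≤ 32 / q := by
      rw [div_le_div_iff₀ hm0' hqpos]
      nlinarith
    have h2 : 32 * (Θ * q ^ 3) ^ 2 / (n : ℝ) ^ 2 ≤ 32 * Θ ^ 2 / q := by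
      rw [← hqn, div_le_div_iff₀ (by positivity) hqpos]
      have : q ^ 7 ≤ q ^ 8 := pow_le_pow_right₀ (by linarith) (by norm_num)
      have h3 : 32 * Θ ^ 2 * q ^ 7 ≤ 32 * Θ ^ 2 * q ^ 8 := by gcongr
      nlinarith
    have h3 : 32 / q + 32 * Θ ^ 2 / q ≤ d / 2 := by
      rw [← add_div, div_le_iff₀ hqpos]
      have : (32 + 32 * Θ ^ 2) / (d / 2) ≤ q := by linarith
      rw [div_le_iff₀ (by positivity)] at this
      linarith
    have h4 : 64 * ε ≤ d / 2 := by rw [hε]; linarith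
    linarith
  · intro v hv
    have hb := hbias v hv
    have hq3 : 0 < q ^ 3 := by positivity
    refine ⟨by linarith, ?_⟩
    calc 25 * (n : ℝ) ^ 2 ≤ (q ^ 2 / 2) * (10 * q ^ 3) ^ 2 := by
          rw [← hqn]
          have : 0 ≤ q ^ 8 := by positivity
          nlinarith
      _ ≤ m * bias v ^ 2 := by gcongr
  · rw [card_stayPairs_stepTuples hBl, card_stepTuples hBl]
    have h := mul_le_mul_of_nonneg_left hclosed hfac.le
    push_cast
    calc _ = m.factorial * (99 / 100 * (C.card : ℝ) * B.card) := by ring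
      _ ≤ _ := h

lemma hammingNorm_add_le {n : ℕ} (v w : Fin n → ZMod 2) :
    hammingNorm (v + w) ≤ hammingNorm v + hammingNorm w := by
  refine le_trans (Finset.card_le_card ?_) (Finset.card_union_le _ _)
  intro i hi
  simp only [Finset.mem_filter, Finset.mem_univ, true_and, Finset.mem_union, Pi.add_apply] at hi ⊢
  by_contra h
  push Not at h
  exact hi (by rw [h.1, h.2, add_zero])

lemma hammingNorm_le_of_mem_iterSumset {n : ℕ} {l : ℕ} {v : Fin n → ZMod 2}
    (hv : v ∈ iterSumset (sqrtLayer n) l) : hammingNorm v ≤ l * Nat.sqrt n := by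
  induction l generalizing v with
  | zero =>
    rw [iterSumset, Finset.mem_singleton] at hv
    simp [hv]
  | succ l ih =>
    obtain ⟨a, ha, b, hb, rfl⟩ := Finset.mem_add.1 hv
    have hb' : hammingNorm b = Nat.sqrt n := mem_cubeLayer.1 hb
    have := hammingNorm_add_le a b
    have := ih ha
    rw [Nat.succ_mul]
    omega

/-- For large `n`, adding `l` vectors of weight at most `√n` costs only a small part of the bias of
the low set. -/
lemma exists_not_almost_closed {δ : ℝ} (hδ : 0 < δ) (l : ℕ) : ∃ N : ℕ, ∀ n : ℕ, N ≤ n →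
    ∀ C B : Finset (Fin n → ZMod 2), C.Nonempty →
      C ⊆ lowSet n + iterSumset (sqrtLayer n) l → B ⊆ sqrtLayer n →
      δ * ((sqrtLayer n).card : ℝ) ≤ B.card → ¬ IsClosedWrt B (99 / 100) C := by
  obtain ⟨Q, hQ⟩ := exists_not_almost_closed_of_bias hδ
  obtain ⟨N, hN⟩ := exists_forall_quarter_root_ge (max Q l)
  refine ⟨N, fun n hn C B hC hCsub hB hBcard => ?_⟩
  obtain ⟨q, hq0, hqn, hq3, hmq, hmq'⟩ := exists_quarter_root n
  have hqQ := hN n hn q hq0 hqn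
  refine hQ n q hq0 hqn ((le_max_left _ _).trans hqQ) hmq' hmq C B hC ?_ hB hBcard
  intro v hv
  obtain ⟨a, ha, b, hb, rfl⟩ := Finset.mem_add.1 (hCsub hv)
  have h1 := (Finset.mem_filter.1 ha).2
  have h2 : (hammingNorm b : ℝ) ≤ l * Nat.sqrt n := by
    exact_mod_cast hammingNorm_le_of_mem_iterSumset hb
  have h3 : (hammingNorm (a + b) : ℝ) ≤ hammingNorm a + hammingNorm b := by
    exact_mod_cast hammingNorm_add_le a b
  have h4 : (l : ℝ) * Nat.sqrt n ≤ q * q ^ 2 :=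
    mul_le_mul ((le_max_right _ _).trans hqQ) hmq (Nat.cast_nonneg _) hq0
  rw [hq3] at h1
  rw [bias_eq]
  have h5 : 0 ≤ q ^ 3 := by positivity
  linarith

/-! ### Hamming balls below the middle are closed with constant density -/

/-- The Hamming ball of radius `r` about the origin. -/
noncomputable def hammingBall (n : ℕ) (r : ℝ) : Finset (Fin n → ZMod 2) :=
  Finset.univ.filter (fun v => (hammingNorm v : ℝ) ≤ r)

lemma mem_hammingBall {n : ℕ} {r : ℝ} {v : Fin n → ZMod 2} :
    v ∈ hammingBall n r ↔ (hammingNorm v : ℝ) ≤ r := by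
  simp [hammingBall]

lemma card_hammingBall_natCast (n T : ℕ) :
    (hammingBall n T).card = ∑ k ∈ Finset.range (T + 1), n.choose k := by
  rw [Finset.card_eq_sum_card_fiberwise (f := hammingNorm) (t := Finset.range (T + 1))]
  · refine Finset.sum_congr rfl fun k hk => ?_
    rw [← card_cubeLayer]
    congr 1
    ext v
    simp only [Finset.mem_filter, mem_hammingBall, mem_cubeLayer, Nat.cast_le]
    have := Finset.mem_range.1 hk
    omega
  · intro v hv
    have h := mem_hammingBall.1 hv
    rw [Nat.cast_le] at h
    simpa using Nat.lt_succ_of_le h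

lemma choose_succ_le {n k : ℕ} {x : ℝ} (h : (n : ℝ) - 2 * k ≤ x * k) (hx : 0 ≤ x) (hk : k ≤ n) :
    (n.choose (k + 1) : ℝ) ≤ (1 + x) * n.choose k := by
  have e : (n.choose (k + 1) : ℝ) * (k + 1) = n.choose k * (n - k) := by
    have := Nat.choose_succ_right_eq n k
    rw [← Nat.cast_sub hk]
    exact_mod_cast this
  have hk1 : (0 : ℝ) < k + 1 := by positivity
  refine le_of_mul_le_mul_right ?_ hk1
  rw [e]
  have h1 : (n : ℝ) - k ≤ (1 + x) * (k + 1) := by nlinarith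
  calc (n.choose k : ℝ) * (n - k) ≤ n.choose k * ((1 + x) * (k + 1)) := by gcongr
    _ = _ := by ring

lemma choose_add_le {n k : ℕ} {x : ℝ} (h : (n : ℝ) - 2 * k ≤ x * k) (hx : 0 ≤ x) (D : ℕ)
    (hk : k + D ≤ n) : (n.choose (k + D) : ℝ) ≤ (1 + x) ^ D * n.choose k := by
  induction D with
  | zero => simp
  | succ D ih =>
    have h1 : (n.choose (k + D + 1) : ℝ) ≤ (1 + x) * n.choose (k + D) := by
      refine choose_succ_le ?_ hx (by omega)
      push_cast
      have : 0 ≤ x * D := by positivity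
      have : (0 : ℝ) ≤ D := by positivity
      linarith
    calc (n.choose (k + (D + 1)) : ℝ) ≤ (1 + x) * n.choose (k + D) := h1
      _ ≤ (1 + x) * ((1 + x) ^ D * n.choose k) := by
          have := ih (by omega)
          gcongr
      _ = _ := by ring

/-- Shrinking the radius of a ball costs at most a constant factor when consecutive layers near
its boundary are comparable. -/
lemma card_hammingBall_le_mul {n T D : ℕ} {x : ℝ} (hx : 0 ≤ x) (hT : 2 * D ≤ T) (hTn : T ≤ n)
    (h : (n : ℝ) - 2 * (T - 2 * D : ℕ) ≤ x * (T - 2 * D : ℕ)) :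
    ((hammingBall n T).card : ℝ) ≤ (1 + (1 + x) ^ D) * (hammingBall n ((T - D : ℕ) : ℝ)).card := by
  rw [card_hammingBall_natCast, card_hammingBall_natCast]
  have hsplit : T + 1 = (T - D + 1) + D := by omega
  have hsplit' : T - D + 1 = (T - 2 * D + 1) + D := by omega
  rw [hsplit, Finset.sum_range_add]
  push_cast
  have h1 : ∑ i ∈ Finset.range D, (n.choose (T - D + 1 + i) : ℝ) ≤
      (1 + x) ^ D * ∑ i ∈ Finset.range D, (n.choose (T - 2 * D + 1 + i) : ℝ) := by
    rw [Finset.mul_sum]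
    refine Finset.sum_le_sum fun i hi => ?_
    have hi := Finset.mem_range.1 hi
    have e : T - D + 1 + i = T - 2 * D + 1 + i + D := by omega
    rw [e]
    refine choose_add_le ?_ hx D (by omega)
    push_cast
    have : 0 ≤ x * (1 + i) := by positivity
    have : (0 : ℝ) ≤ i := by positivity
    linarith
  have h2 : ∑ i ∈ Finset.range D, (n.choose (T - 2 * D + 1 + i) : ℝ) ≤
      ∑ k ∈ Finset.range (T - D + 1), (n.choose k : ℝ) := by
    rw [hsplit', Finset.sum_range_add]
    have : (0 : ℝ) ≤ ∑ k ∈ Finset.range (T - 2 * D + 1), (n.choose k : ℝ) := by positivity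
    linarith
  have h3 := mul_le_mul_of_nonneg_left h2 (show 0 ≤ (1 + x) ^ D by positivity)
  linarith

lemma hammingNorm_add_entryVec {n m : ℕ} (v : Fin n → ZMod 2) {ω : Fin m → Fin n}
    (hω : Function.Injective ω) :
    (hammingNorm (v + entryVec ω) : ℝ) = hammingNorm v + tupleSum (signVec v) ω := by
  have h := bias_add_entryVec v hω
  rw [bias_eq, bias_eq] at h
  linarith

/-- From a vector whose weight is well below the radius of the ball, at least half of the steps
stay in the ball. -/
lemma half_le_card_steps_in_ball {n : ℕ} {q K : ℝ} {D : ℕ} (hq : 0 < q) (hqn : q ^ 4 = n)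
    (hK : 2 ≤ K) (hKq : 2 ≤ K * q) (hmq : (Nat.sqrt n : ℝ) ≤ q ^ 2) (hD : 4 * K * q ≤ D)
    {v : Fin n → ZMod 2} (hv : (hammingNorm v : ℝ) + D ≤ n / 2 - K * q ^ 3) :
    ((sqrtLayer n).card : ℝ) / 2 ≤
      ((sqrtLayer n).filter (fun b => v + b ∈ hammingBall n (n / 2 - K * q ^ 3))).card := by
  set A := hammingBall n (n / 2 - K * q ^ 3) with hA
  set m := Nat.sqrt n with hm
  have hn' : (0 : ℝ) < n := by rw [← hqn]; positivity
  have hn : 0 < n := by exact_mod_cast hn'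
  have hm0 : 0 < m := Nat.sqrt_pos.2 hn
  have hm0' : (0 : ℝ) < m := by exact_mod_cast hm0
  have hfac : (0 : ℝ) < m.factorial := by exact_mod_cast m.factorial_pos
  have hlayer : sqrtLayer n = cubeLayer n m := rfl
  rw [hlayer]
  set Ω := stepTuples m (cubeLayer n m) with hΩ
  have hΩcard : (Ω.card : ℝ) = m.factorial * (cubeLayer n m).card := by
    exact_mod_cast card_stepTuples (subset_refl (cubeLayer n m))
  have hΩlow : (n : ℝ) ^ m / 2 ≤ Ω.card := by
    rw [hΩ, card_stepTuples_cubeLayer]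
    exact half_pow_le_descFactorial (Nat.sqrt_le' n)
  have hgood : ((Ω.filter (fun ω => v + entryVec ω ∈ A)).card : ℝ) =
      m.factorial * ((cubeLayer n m).filter (fun b => v + b ∈ A)).card := by
    rw [hΩ, filter_stepTuples, card_stepTuples (Finset.filter_subset _ _)]
    push_cast
    rfl
  have hbad : ((Ω.filter (fun ω => ¬ v + entryVec ω ∈ A)).card : ℝ) ≤ (n : ℝ) ^ m / 4 := by
    suffices hfar : ∀ ω ∈ Ω.filter (fun ω => ¬ v + entryVec ω ∈ A),
        4 * (m : ℝ) ≤ (tupleSum (signVec v) ω - m * (bias v / n)) ^ 2 by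
      have h1 := (Finset.card_nsmul_le_sum _ _ _ hfar).trans
        (Finset.sum_le_univ_sum_of_nonneg fun ω => sq_nonneg _)
      have h2 := h1.trans (sum_sq_tupleSum_signVec_le hn v m)
      rw [nsmul_eq_mul] at h2
      refine le_of_mul_le_mul_right ?_ hm0'
      linarith
    intro ω hω
    -- A step leaving the ball starts within `m` of its boundary, so the bias of `v` is at most
    -- `3 K q ^ 3`, the mean gain is at most `3 K q`, and the actual gain exceeds `D ≥ 4 K q`.
    obtain ⟨hω, hnot⟩ := Finset.mem_filter.1 hω
    have hinj := (mem_stepTuples.1 hω).1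
    rw [hA, mem_hammingBall, not_le, hammingNorm_add_entryVec v hinj] at hnot
    have hS := (abs_le.1 (abs_tupleSum_signVec_le v ω)).2
    have hq3 : 2 * q ^ 2 ≤ K * q ^ 3 := by
      have := mul_le_mul_of_nonneg_right hKq (sq_nonneg q)
      linarith
    have hb : bias v ≤ 3 * K * q ^ 3 := by
      rw [bias_eq]
      linarith
    have hdrift : m * (bias v / n) ≤ 3 * K * q := by
      calc m * (bias v / n) ≤ m * (3 * K * q ^ 3 / n) := by gcongr
        _ ≤ q ^ 2 * (3 * K * q ^ 3 / n) := by gcongr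
        _ = 3 * K * q := by rw [← hqn]; field_simp
    have hgap : K * q ≤ tupleSum (signVec v) ω - m * (bias v / n) := by linarith
    calc 4 * (m : ℝ) ≤ 2 ^ 2 * q ^ 2 := by linarith
      _ ≤ K ^ 2 * q ^ 2 := by gcongr
      _ = (K * q) ^ 2 := by ring
      _ ≤ _ := by gcongr
  have hsum : ((Ω.filter (fun ω => v + entryVec ω ∈ A)).card : ℝ) +
      ((Ω.filter (fun ω => ¬ v + entryVec ω ∈ A)).card : ℝ) = Ω.card := by
    exact_mod_cast Finset.card_filter_add_card_filter_not (s := Ω) (fun ω => v + entryVec ω ∈ A)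
  refine le_of_mul_le_mul_left ?_ hfac
  rw [← hgood, ← mul_div_assoc, ← hΩcard]
  linarith

/-- A ball of radius `n / 2 - K n ^ (3 / 4)` is closed, with a density depending only on `K`, with
respect to the layer of weight `⌊√n⌋`. -/
lemma isClosedWrt_hammingBall {n : ℕ} {q K : ℝ} (hqn : q ^ 4 = n) (hK : 2 ≤ K)
    (hKq : 20 * K ≤ q) (hmq : (Nat.sqrt n : ℝ) ≤ q ^ 2) :
    IsClosedWrt (sqrtLayer n) (1 / (2 * (1 + Real.exp (16 * K * (4 * K + 1)))))
      (hammingBall n (n / 2 - K * q ^ 3)) := by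
  have hq1 : 40 ≤ q := by linarith
  have hq : 0 < q := by linarith
  set E := Real.exp (16 * K * (4 * K + 1)) with hE
  set A := hammingBall n (n / 2 - K * q ^ 3) with hA
  set D : ℕ := ⌈4 * K * q⌉₊ with hDdef
  have hD1 : 4 * K * q ≤ D := Nat.le_ceil _
  have hD2 : (D : ℝ) < 4 * K * q + 1 := Nat.ceil_lt_add_one (by positivity)
  have hKq3 : K * q ^ 3 ≤ n / 20 := by
    rw [← hqn]
    have : 20 * K * q ^ 3 ≤ q * q ^ 3 := by gcongr
    linarith
  have hlin : 8 * K * q + 4 ≤ K * q ^ 3 := by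
    have h2 : 1600 ≤ q ^ 2 := by nlinarith
    have h3 : K * q * 1600 ≤ K * q * q ^ 2 := by gcongr
    nlinarith
  have hr0 : 0 ≤ (n : ℝ) / 2 - K * q ^ 3 := by
    have : (0 : ℝ) ≤ n := Nat.cast_nonneg _
    linarith
  set T : ℕ := ⌊(n : ℝ) / 2 - K * q ^ 3⌋₊ with hTdef
  have hT1 : (T : ℝ) ≤ n / 2 - K * q ^ 3 := Nat.floor_le hr0
  have hT2 : (n : ℝ) / 2 - K * q ^ 3 < T + 1 := Nat.lt_floor_add_one _
  have hAT : A = hammingBall n (T : ℝ) := by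
    ext v
    rw [hA, mem_hammingBall, mem_hammingBall, Nat.cast_le, hTdef, Nat.le_floor_iff hr0]
  have hTDreal : 2 * (D : ℝ) ≤ T := by linarith
  have hTD : 2 * D ≤ T := by exact_mod_cast hTDreal
  have hTn : T ≤ n := by
    have : (T : ℝ) ≤ n := by
      have : 0 ≤ K * q ^ 3 := by positivity
      have : (0 : ℝ) ≤ n := Nat.cast_nonneg _
      linarith
    exact_mod_cast this
  set A' := hammingBall n ((T - D : ℕ) : ℝ) with hA'
  have hcard : (A.card : ℝ) ≤ (1 + E) * A'.card := by
    rw [hAT]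
    have hx : 0 ≤ 16 * K / q := by positivity
    refine (card_hammingBall_le_mul hx hTD hTn ?_).trans ?_
    -- The ratio of consecutive layers is controlled from weight `T - 2 D ≥ n / 4` on.
    · have hbase : (n : ℝ) / 4 ≤ ((T - 2 * D : ℕ) : ℝ) := by
        rw [Nat.cast_sub hTD]
        push_cast
        linarith
      have h1 : 16 * K / q * (n / 4) ≤ 16 * K / q * ((T - 2 * D : ℕ) : ℝ) := by gcongr
      have h2 : 16 * K / q * ((n : ℝ) / 4) = 4 * K * q ^ 3 := by
        rw [← hqn]; field_simp; norm_num
      rw [h2] at h1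
      refine le_trans ?_ h1
      rw [Nat.cast_sub hTD]
      push_cast
      linarith
    · have hpow : (1 + 16 * K / q) ^ D ≤ E := by
        calc (1 + 16 * K / q) ^ D ≤ Real.exp (16 * K / q) ^ D := by
              gcongr
              linarith [Real.add_one_le_exp (16 * K / q)]
          _ = Real.exp (D * (16 * K / q)) := (Real.exp_nat_mul _ _).symm
          _ ≤ E := by
              refine Real.exp_le_exp.2 ?_
              have h1 : (D : ℝ) ≤ (4 * K + 1) * q := by linarith
              calc D * (16 * K / q) ≤ (4 * K + 1) * q * (16 * K / q) := by gcongr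
                _ = _ := by field_simp
      gcongr
  have hsub : A' ⊆ A := by
    intro v hv
    rw [hAT, mem_hammingBall]
    exact (mem_hammingBall.1 hv).trans (Nat.cast_le.2 (Nat.sub_le _ _))
  have hpairs : (A'.card : ℝ) * ((sqrtLayer n).card / 2) ≤
      (((A ×ˢ sqrtLayer n).filter (fun p => p.1 + p.2 ∈ A)).card : ℝ) := by
    rw [card_filter_product_eq_sum]
    push_cast
    rw [← nsmul_eq_mul, ← Finset.sum_const]
    refine (Finset.sum_le_sum fun v hv => ?_).trans
      (Finset.sum_le_sum_of_subset_of_nonneg hsub fun _ _ _ => Nat.cast_nonneg _)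
    refine half_le_card_steps_in_ball hq hqn hK (by nlinarith) hmq hD1 ?_
    have h1 := mem_hammingBall.1 hv
    rw [Nat.cast_sub (by omega)] at h1
    linarith
  have hE0 : 0 < E := Real.exp_pos _
  unfold IsClosedWrt
  refine le_trans ?_ hpairs
  calc 1 / (2 * (1 + E)) * (A.card : ℝ) * (sqrtLayer n).card
      ≤ 1 / (2 * (1 + E)) * ((1 + E) * A'.card) * (sqrtLayer n).card := by gcongr
    _ = _ := by field_simp

lemma lowSet_eq_hammingBall {n : ℕ} {q : ℝ} (hq : (n : ℝ) ^ (3 / 4 : ℝ) = q ^ 3) :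
    lowSet n = hammingBall n (n / 2 - 10 ^ 20 * q ^ 3) := by
  rw [lowSet, hq, hammingBall]

/-! ### Supports of convolutions -/

lemma exists_of_conv_ne_zero {G : Type} [AddCommGroup G] [Fintype G] {f g : G → ℝ} {x : G}
    (h : conv f g x ≠ 0) : ∃ y, f y ≠ 0 ∧ g (x - y) ≠ 0 := by
  have h1 : ∑ y : G, f y * g (x - y) ≠ 0 := fun h0 => h (by rw [conv, h0, zero_div])
  obtain ⟨y, -, hy⟩ := Finset.exists_ne_zero_of_sum_ne_zero h1
  exact ⟨y, left_ne_zero_of_mul hy, right_ne_zero_of_mul hy⟩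

/-- Each further convolution with `μ_B` adds one copy of `B` to the support. -/
lemma mem_of_convIter_ne_zero {G : Type} [AddCommGroup G] [Fintype G] [DecidableEq G]
    {f : G → ℝ} {A B : Finset G} {k : ℕ} (hf : ∀ x, f x ≠ 0 → x ∈ A + iterSumset B k) (l : ℕ) :
    ∀ x, convIter f (charMeasure B) l x ≠ 0 → x ∈ A + iterSumset B (k + l) := by
  induction l with
  | zero => exact hf
  | succ l ih =>
    intro x hx
    obtain ⟨y, hy, hxy⟩ := exists_of_conv_ne_zero hx
    have hB : x - y ∈ B := by
      by_contra hnot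
      exact hxy (if_neg hnot)
    have h := Finset.add_mem_add (ih y hy) hB
    rw [add_sub_cancel, add_assoc] at h
    exact h

lemma neg_finset_cube {n : ℕ} (B : Finset (Fin n → ZMod 2)) : -B = B := by
  have h : ∀ v : Fin n → ZMod 2, -v = v := fun v => funext fun i => CharTwo.neg_eq _
  ext v
  rw [Finset.mem_neg']
  rw [h]

lemma nonempty_of_large {n : ℕ} {q : ℝ} (hqn : q ^ 4 = n)
    (hq3 : (n : ℝ) ^ (3 / 4 : ℝ) = q ^ 3) (hq : 2 * 10 ^ 20 ≤ q) :
    (lowSet n).Nonempty ∧ (sqrtLayer n).Nonempty := by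
  constructor
  · refine ⟨0, ?_⟩
    rw [lowSet_eq_hammingBall hq3, mem_hammingBall, hammingNorm_zero, ← hqn]
    have h0 : 0 ≤ q ^ 3 := pow_nonneg (le_trans (by norm_num) hq) 3
    have : 2 * 10 ^ 20 * q ^ 3 ≤ q * q ^ 3 := by gcongr
    push_cast
    linarith
  · have h : (sqrtLayer n).card = n.choose (Nat.sqrt n) := card_cubeLayer n _
    rw [← Finset.card_pos, h]
    exact Nat.choose_pos (Nat.sqrt_le_self n)

theorem mainTheorem3 :
    ∃ η : ℝ, 0 < η ∧
      (∃ N : ℕ, ∀ n : ℕ, N ≤ n → IsClosedWrt (sqrtLayer n) η (lowSet n)) ∧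
      (∀ δ : ℝ, 0 < δ → ∀ l : ℕ, 0 < l → ∃ N : ℕ, ∀ n : ℕ, N ≤ n →
        ¬ ∃ C B' : Finset (Fin n → ZMod 2),
          C.Nonempty ∧ C ⊆ lowSet n + iterSumset (sqrtLayer n) l ∧
          B' ⊆ sqrtLayer n ∧ δ * ((sqrtLayer n).card : ℝ) ≤ (B'.card : ℝ) ∧
          IsClosedWrt B' (99 / 100) C) ∧
      (∀ c : ℝ, 0 < c → ∀ δ : ℝ, 0 < δ → ∀ l : ℕ, 0 < l →
        ¬ ClosedStructure η (1 / 100) c δ l) ∧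
      ¬ ClosedStructureQuestion := by
  -- Generalizing the constant to `K` keeps the numeral out of the arithmetic below.
  obtain ⟨K, hK⟩ : ∃ K : ℝ, K = 10 ^ 20 := ⟨_, rfl⟩
  have hK2 : 2 ≤ K := by rw [hK]; norm_num
  set η : ℝ := 1 / (2 * (1 + Real.exp (16 * K * (4 * K + 1)))) with hη
  have hη0 : 0 < η := by have := Real.exp_pos (16 * K * (4 * K + 1)); positivity
  have hclosed : ∃ N : ℕ, ∀ n : ℕ, N ≤ n → IsClosedWrt (sqrtLayer n) η (lowSet n) ∧
      (lowSet n).Nonempty ∧ (sqrtLayer n).Nonempty := by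
    obtain ⟨N, hN⟩ := exists_forall_quarter_root_ge (20 * K)
    refine ⟨N, fun n hn => ?_⟩
    obtain ⟨q, hq0, hqn, hq3, hmq, -⟩ := exists_quarter_root n
    have hq := hN n hn q hq0 hqn
    refine ⟨?_, nonempty_of_large hqn hq3 (by rw [← hK]; linarith)⟩
    rw [lowSet_eq_hammingBall hq3, ← hK]
    exact isClosedWrt_hammingBall hqn hK2 hq hmq
  have hfail : ∀ c : ℝ, 0 < c → ∀ δ : ℝ, 0 < δ → ∀ l : ℕ, 0 < l →
      ¬ ClosedStructure η (1 / 100) c δ l := by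
    intro c hc δ hδ l _ hP
    obtain ⟨N₁, hN₁⟩ := hclosed
    obtain ⟨N₂, hN₂⟩ := exists_not_almost_closed hδ (l + l)
    set n := max N₁ N₂
    obtain ⟨hcl, hA, hB⟩ := hN₁ n (le_max_left _ _)
    obtain ⟨B', C, hB', hC, hcard, hBC, hconv⟩ :=
      hP (Fin n → ZMod 2) (lowSet n) (sqrtLayer n) hA hB hcl
    refine hN₂ n (le_max_right _ _) C B' hC ?_ hB' hcard ?_
    · intro x hx
      have hpos := hconv x hx
      rw [neg_finset_cube] at hpos
      have hsupp := mem_of_convIter_ne_zero (A := lowSet n)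
        (mem_of_convIter_ne_zero (A := lowSet n) (f := ind (lowSet n)) (k := 0) ?_ l) l x
        (lt_of_lt_of_le hc hpos).ne'
      · rwa [zero_add] at hsupp
      intro y hy
      have hyA : y ∈ lowSet n := by
        by_contra hnot
        exact hy (if_neg hnot)
      exact Finset.mem_add.2 ⟨y, hyA, 0, Finset.mem_singleton_self 0, add_zero y⟩
    · have e : (1 : ℝ) - 1 / 100 = 99 / 100 := by norm_num
      rwa [e] at hBC
  refine ⟨η, hη0, ?_, ?_, hfail, ?_⟩
  · obtain ⟨N, hN⟩ := hclosed
    exact ⟨N, fun n hn => (hN n hn).1⟩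
  · intro δ hδ l _
    obtain ⟨N, hN⟩ := exists_not_almost_closed hδ l
    refine ⟨N, fun n hn => ?_⟩
    rintro ⟨C, B', hC, hCsub, hB', hcard, hcl⟩
    exact hN n hn C B' hC hCsub hB' hcard hcl
  · intro hQ
    obtain ⟨c, hc, δ, hδ, l, hl, hP⟩ := hQ η hη0 (1 / 100) (by norm_num)
    exact hfail c hc δ hδ l hl hP
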